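/- There is an absolute constant $C>0$ such that the following holds. Let $(a_n)_{n\ge 1}$ be a bounded sequence of complex numbers and let $M$ be a real number with $|a_n|\le M$ for all $n\ge 1$. Then for every integer $N\ge 2$, $$\Big|\frac{1}{\pi(N)}\sum_{\substack{p\le N\\ p\ \text{prime}}}a_p-\frac1N\sum_{n=1}^{N}\Lambda(n)a_n\Big|\le M\left(\frac{8C}{\log N}+\frac{6C^2}{(\log N)^2}+\frac{(\log N)^2}{2\sqrt N\,\log 2}\right).$$ Here $\pi(N)$ is the number of primes $p\le N$, and $\Lambda$ is the von Mangoldt function: $\Lambda(n)=\log p$ if $n=p^\alpha$ for a prime $p$ and an integer $\alpha\ge1$, and $\Lambda(n)=0$ otherwise. In particular, if $|a_n|\le 1$ for all $n\ge1$, the bound holds with $M=1$. -/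

import Mathlib

/-!
The two averages differ by `∑_p (1/π(N) - log p / N) a_p` and by the contribution of proper prime
powers, so everything reduces to bounding the `ℓ¹` distance of the weights `1/π(N)` and
`log p / N` on the primes `p ≤ N` by a multiple of `1 / log N`. Since `log p` is close to `log N`
on average (`exists_primeCounting_mul_log_sub_le`), this is the prime number theorem with error
term, `ψ(N) = N + O(N / log N)` (`exists_abs_sum_vonMangoldt_sub_le`). Constant sequences show that
such an error term cannot be avoided.

The prime number theorem in this form is proved as follows. The function `F = -ζ'/ζ - ζ` is the
Dirichlet series of `Λ - 1`, and is holomorphic on a neighbourhood of `re s ≥ 1`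
(`zetaDiff`). Euler–Maclaurin summation bounds `ζ` by `|t| ^ (1/20)` slightly to the left of the
line `re s = 1` (`exists_norm_riemannZeta_le`); the `3-4-1` inequality gives a lower bound for
`|ζ|` in a zero-free region whose width is a small negative power of `|t|`
(`exists_le_norm_riemannZeta`). By Cauchy's estimate, `F''(s) = O(|t| ^ (3/4))` uniformly for
`re s ≥ 1` (`exists_norm_iteratedDeriv_zetaDiff_le`). The exponent is less than `1`, so `F''` is
absolutely integrable against the Mellin transform `1 / (s (s + 1))` of the weight `(1 - t)₊`, and
Mellin inversion on the line `re s = 1 + 1 / (4 log N)` yields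
`∑_{n ≤ N} log² n (Λ(n) - 1) (N - n) = O(N²)` (`exists_abs_sum_riesz_le`), with no saving from the
integral: the factor `log²` produced by the two derivatives is the saving. Taking differences over
an interval of length about `N / log N` removes the weight `N - n` (`mul_abs_sum_le_of_riesz`), at
the cost of one logarithm. The weights `log² n` may then be replaced by `log² N`, because
`log(N/n)` is bounded on average.
-/

/-! ### The zeta function near the line `re s = 1` -/

section

open Complex Filter Topology Set MeasureTheory

/-- The entire function `(s - 1) ζ(s)`, with its value `1` at `s = 1` filled in. -/
noncomputable def zetaMulSub : ℂ → ℂ := Function.update (fun s => (s - 1) * riemannZeta s) 1 1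

lemma zetaMulSub_one : zetaMulSub 1 = 1 := by simp [zetaMulSub]

lemma zetaMulSub_of_ne {s : ℂ} (hs : s ≠ 1) : zetaMulSub s = (s - 1) * riemannZeta s := by
  simp [zetaMulSub, hs]

lemma differentiable_zetaMulSub : Differentiable ℂ zetaMulSub := by
  have h : DifferentiableOn ℂ zetaMulSub univ := by
    rw [← differentiableOn_compl_singleton_and_continuousAt_iff (c := 1) univ_mem]
    refine ⟨fun s hs => ?_, ?_⟩
    · have hs1 : s ≠ 1 := hs.2
      have : DifferentiableAt ℂ (fun s => (s - 1) * riemannZeta s) s :=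
        (by fun_prop : DifferentiableAt ℂ (fun s : ℂ => s - 1) s).mul
          (differentiableAt_riemannZeta hs1)
      refine (this.congr_of_eventuallyEq ?_).differentiableWithinAt
      filter_upwards [isOpen_ne.mem_nhds hs1] with z hz using zetaMulSub_of_ne hz
    · rw [zetaMulSub, continuousAt_update_same]
      exact riemannZeta_residue_one
  exact fun s => (h s (mem_univ s)).differentiableAt univ_mem

lemma zetaMulSub_ne_zero {s : ℂ} (hs : 1 ≤ s.re) : zetaMulSub s ≠ 0 := by
  by_cases h : s = 1
  · simp [h, zetaMulSub_one]
  · rw [zetaMulSub_of_ne h]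
    exact mul_ne_zero (sub_ne_zero.2 h) (riemannZeta_ne_zero_of_one_le_re hs)

/-- The truncated fractional part `{u} 1_{u > N}`. -/
noncomputable def fractTail (N : ℕ) : ℝ → ℂ :=
  (Ioi (N : ℝ)).indicator fun u => ((Int.fract u : ℝ) : ℂ)

lemma norm_fractTail_le (N : ℕ) (u : ℝ) : ‖fractTail N u‖ ≤ 1 := by
  by_cases h : u ∈ Ioi (N : ℝ)
  · rw [fractTail, indicator_of_mem h, norm_real, Real.norm_of_nonneg (Int.fract_nonneg u)]
    exact (Int.fract_lt_one u).le
  · rw [fractTail, indicator_of_notMem h]; simp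

lemma measurable_fractTail (N : ℕ) : Measurable (fractTail N) :=
  (measurable_ofReal.comp measurable_fract).indicator measurableSet_Ioi

lemma differentiableAt_mellin_fractTail {N : ℕ} (hN : 1 ≤ N) {s : ℂ} (hs : s.re < 0) :
    DifferentiableAt ℂ (mellin (fractTail N)) s := by
  refine mellin_differentiableAt_of_isBigO_rpow (a := 0) (b := s.re - 1) ?_ ?_ hs ?_ (by linarith)
  · refine LocallyIntegrable.locallyIntegrableOn ?_ _
    refine (locallyIntegrable_const (1 : ℝ)).mono (measurable_fractTail N).aestronglyMeasurable ?_
    exact Eventually.of_forall fun u => by simpa using norm_fractTail_le N u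
  · simp only [neg_zero, Real.rpow_zero]
    exact Asymptotics.IsBigO.of_bound 1
      (Eventually.of_forall fun u => by simpa using norm_fractTail_le N u)
  · have : fractTail N =ᶠ[𝓝[>] 0] fun _ => 0 := by
      have h1 : Iio (N : ℝ) ∈ 𝓝[>] (0 : ℝ) :=
        mem_nhdsWithin_of_mem_nhds (Iio_mem_nhds (by exact_mod_cast hN))
      filter_upwards [h1] with u hu
      exact indicator_of_notMem (by simpa using (le_of_lt hu)) _
    exact this.trans_isBigO (Asymptotics.isBigO_zero _ _)

lemma mellin_fractTail_neg {N : ℕ} (hN : 1 ≤ N) (s : ℂ) : mellin (fractTail N) (-s) =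
    ∫ u in Ioi (N : ℝ), (u : ℂ) ^ (-s - 1) * ((Int.fract u : ℝ) : ℂ) := by
  have hN0 : (0 : ℝ) < N := by exact_mod_cast hN
  rw [mellin]
  have : ∀ u : ℝ, (u : ℂ) ^ (-s - 1) • fractTail N u =
      (Ioi (N : ℝ)).indicator (fun u : ℝ => (u : ℂ) ^ (-s - 1) * ((Int.fract u : ℝ) : ℂ)) u := by
    intro u
    by_cases h : u ∈ Ioi (N : ℝ) <;> simp [fractTail, h, indicator]
  simp_rw [this]
  rw [setIntegral_indicator measurableSet_Ioi]
  congr 2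
  exact inter_eq_right.2 (Ioi_subset_Ioi hN0.le)

lemma norm_mellin_fractTail_le {N : ℕ} (hN : 1 ≤ N) {s : ℂ} (hs : 0 < s.re) :
    ‖mellin (fractTail N) (-s)‖ ≤ (N : ℝ) ^ (-s.re) / s.re := by
  have hN0 : (0 : ℝ) < N := by exact_mod_cast hN
  rw [mellin_fractTail_neg hN]
  calc _ ≤ ∫ u in Ioi (N : ℝ), u ^ (-s.re - 1) := by
        refine norm_integral_le_of_norm_le
          (integrableOn_Ioi_rpow_of_lt (by linarith) hN0) ?_
        refine (ae_restrict_iff' measurableSet_Ioi).2 (Eventually.of_forall fun u hu => ?_)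
        have hu0 : 0 < u := hN0.trans hu
        rw [norm_mul, norm_cpow_eq_rpow_re_of_pos hu0, norm_real,
          Real.norm_of_nonneg (Int.fract_nonneg u)]
        simpa using mul_le_of_le_one_right (Real.rpow_nonneg hu0.le _) (Int.fract_lt_one u).le
    _ = _ := by
        rw [integral_Ioi_rpow_of_lt (by linarith) hN0]
        rw [show -s.re - 1 + 1 = -s.re by ring]
        field_simp

lemma riemannZeta_eq_sum_add_of_one_lt {N : ℕ} (hN : 1 ≤ N) {s : ℂ} (hs : 1 < s.re) :
    riemannZeta s = ∑ n ∈ Finset.Icc 1 N, (n : ℂ) ^ (-s) + (N : ℂ) ^ (1 - s) / (s - 1)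
      - s * mellin (fractTail N) (-s) := by
  have hN0 : (0 : ℝ) < N := by exact_mod_cast hN
  -- the Dirichlet series of `1_{n > N}` has summatory function `⌊t⌋ - N` beyond `N`
  set f : ℕ → ℂ := fun n => if N < n then 1 else 0 with hf
  have hsum : ∀ n : ℕ, ∑ k ∈ Finset.Icc 1 n, f k = ((n - N : ℕ) : ℂ) := by
    intro n
    rw [hf, Finset.sum_ite, Finset.sum_const_zero, add_zero, Finset.sum_const, nsmul_eq_mul, mul_one]
    congr 1
    have : {x ∈ Finset.Icc 1 n | N < x} = Finset.Ioc N n := by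
      ext x; simp; omega
    rw [this, Nat.card_Ioc]
  have hS1 : LSeriesSummable 1 s := LSeriesSummable_one_iff.2 hs
  set g : ℕ → ℂ := fun n => if n ≤ N then 1 else 0 with hg
  have hgterm : ∀ n, n ∉ Finset.Icc 1 N → LSeries.term g s n = 0 := by
    intro n hn
    rcases eq_or_ne n 0 with rfl | h0
    · simp
    · have : ¬ n ≤ N := fun h => hn (Finset.mem_Icc.2 ⟨by omega, h⟩)
      simp [LSeries.term_of_ne_zero h0, hg, this]
  have hgS : LSeriesSummable g s := summable_of_ne_finset_zero (s := Finset.Icc 1 N) hgterm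
  have hfg : f = 1 - g := by
    ext n
    by_cases h : n ≤ N <;> simp [hf, hg, h]
  have hfS : LSeriesSummable f s := hfg ▸ hS1.sub hgS
  have hgL : LSeries g s = ∑ n ∈ Finset.Icc 1 N, (n : ℂ) ^ (-s) := by
    rw [LSeries, tsum_eq_sum hgterm]
    refine Finset.sum_congr rfl fun n hn => ?_
    have := Finset.mem_Icc.1 hn
    rw [LSeries.term_of_ne_zero (by omega), hg]
    simp [this.2, cpow_neg]
  have hL : LSeries f s = riemannZeta s - ∑ n ∈ Finset.Icc 1 N, (n : ℂ) ^ (-s) := by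
    rw [hfg, LSeries_sub hS1 hgS, hgL, LSeries_one_eq_riemannZeta hs]
  have hO : (fun n ↦ ∑ k ∈ Finset.Icc 1 n, f k) =O[atTop] fun n : ℕ ↦ (n : ℝ) ^ (1 : ℝ) := by
    refine Asymptotics.IsBigO.of_bound 1 (Eventually.of_forall fun n => ?_)
    rw [hsum]
    simp
  have key := LSeries_eq_mul_integral f zero_le_one hs hfS hO
  have hint : ∫ t in Ioi (1 : ℝ), (∑ k ∈ Finset.Icc 1 ⌊t⌋₊, f k) * (t : ℂ) ^ (-(s + 1)) =
      ∫ t in Ioi (N : ℝ), ((t : ℂ) ^ (-s) - N * (t : ℂ) ^ (-s - 1) -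
        (t : ℂ) ^ (-s - 1) * ((Int.fract t : ℝ) : ℂ)) := by
    rw [setIntegral_eq_of_subset_of_forall_sdiff_eq_zero (s := Ioi (N : ℝ)) measurableSet_Ioi
      (Ioi_subset_Ioi (by exact_mod_cast hN))]
    · refine setIntegral_congr_fun measurableSet_Ioi fun t ht => ?_
      have ht0 : 0 < t := hN0.trans ht
      have hNt : N ≤ ⌊t⌋₊ := Nat.le_floor (le_of_lt ht)
      have h2 : ((⌊t⌋₊ : ℕ) : ℝ) = t - Int.fract t := by
        rw [← Int.self_sub_floor]
        rw [← natCast_floor_eq_intCast_floor ht0.le]; simp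
      have h3 : ((⌊t⌋₊ : ℕ) : ℂ) = t - ((Int.fract t : ℝ) : ℂ) := by
        rw [← ofReal_natCast, h2]; push_cast; rfl
      have h4 : (t : ℂ) ^ (-s) = t * (t : ℂ) ^ (-s - 1) := by
        rw [cpow_sub _ _ (by exact_mod_cast ht0.ne'), cpow_one]
        field_simp [show (t : ℂ) ≠ 0 by exact_mod_cast ht0.ne']
      rw [hsum, Nat.cast_sub hNt, h3, h4, neg_add, ← sub_eq_add_neg]
      ring
    · intro t ht
      have : ⌊t⌋₊ ≤ N := by
        have : t ≤ N := by simpa using ht.2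
        exact Nat.floor_le_of_le this
      rw [hsum, Nat.sub_eq_zero_of_le this]; simp
  have hi1 : IntegrableOn (fun t : ℝ => (t : ℂ) ^ (-s)) (Ioi (N : ℝ)) :=
    integrableOn_Ioi_cpow_of_lt (by simpa using hs) hN0
  have hi2 : IntegrableOn (fun t : ℝ => (N : ℂ) * (t : ℂ) ^ (-s - 1)) (Ioi (N : ℝ)) :=
    (integrableOn_Ioi_cpow_of_lt (by simp; linarith) hN0).const_mul _
  have hi3 : IntegrableOn (fun t : ℝ => (t : ℂ) ^ (-s - 1) * ((Int.fract t : ℝ) : ℂ))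
      (Ioi (N : ℝ)) := by
    refine (integrableOn_Ioi_cpow_of_lt (a := -s - 1) (by simp; linarith) hN0).mul_bdd (c := 1)
      (measurable_ofReal.comp measurable_fract).aestronglyMeasurable ?_
    refine Eventually.of_forall fun u => ?_
    change ‖((Int.fract u : ℝ) : ℂ)‖ ≤ 1
    rw [norm_real, Real.norm_of_nonneg (Int.fract_nonneg u)]
    exact (Int.fract_lt_one u).le
  have hsplit : ∫ t in Ioi (N : ℝ), ((t : ℂ) ^ (-s) - N * (t : ℂ) ^ (-s - 1) -
      (t : ℂ) ^ (-s - 1) * ((Int.fract t : ℝ) : ℂ)) = (∫ t in Ioi (N : ℝ), (t : ℂ) ^ (-s)) -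
      (∫ t in Ioi (N : ℝ), (N : ℂ) * (t : ℂ) ^ (-s - 1)) -
      ∫ t in Ioi (N : ℝ), (t : ℂ) ^ (-s - 1) * ((Int.fract t : ℝ) : ℂ) := by
    rw [← integral_sub hi1 hi2]
    exact integral_sub (hi1.sub hi2) hi3
  rw [hint, hsplit, ← mellin_fractTail_neg hN, integral_const_mul,
    integral_Ioi_cpow_of_lt (by simpa using hs) hN0,
    integral_Ioi_cpow_of_lt (by simp; linarith) hN0, hL] at key
  have hs1 : s - 1 ≠ 0 := by
    intro h
    have : s = 1 := sub_eq_zero.1 h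
    simp [this] at hs
  have hs1' : 1 - s ≠ 0 := by rw [← neg_sub]; exact neg_ne_zero.2 hs1
  have hs0 : s ≠ 0 := by rintro rfl; simp at hs; linarith
  have hN1 : (N : ℂ) * (N : ℂ) ^ (-s) = (N : ℂ) ^ (1 - s) := by
    rw [sub_eq_add_neg, cpow_add _ _ (by exact_mod_cast hN0.ne'), cpow_one]
  rw [eq_add_of_sub_eq key, ofReal_natCast, show -s - 1 + 1 = -s by ring,
    show -s + 1 = 1 - s by ring, ← hN1]
  have : s * (-((N : ℂ) * (N : ℂ) ^ (-s)) / (1 - s) - N * (-(N : ℂ) ^ (-s) / -s)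
      - mellin (fractTail N) (-s)) = (N : ℂ) * (N : ℂ) ^ (-s) / (s - 1)
      - s * mellin (fractTail N) (-s) := by
    field_simp
    ring
  rw [this]
  ring

/-- The continuation of `ζ` to `0 < re s` given by Euler–Maclaurin summation beyond `N`. -/
lemma riemannZeta_eq_sum_add {N : ℕ} (hN : 1 ≤ N) {s : ℂ} (hs : 0 < s.re) (hs1 : s ≠ 1) :
    riemannZeta s = ∑ n ∈ Finset.Icc 1 N, (n : ℂ) ^ (-s) + (N : ℂ) ^ (1 - s) / (s - 1)
      - s * mellin (fractTail N) (-s) := by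
  have hN0 : (N : ℂ) ≠ 0 := by exact_mod_cast (by omega : N ≠ 0)
  set g : ℂ → ℂ := fun s => (s - 1) * ∑ n ∈ Finset.Icc 1 N, (n : ℂ) ^ (-s) + (N : ℂ) ^ (1 - s)
      - (s - 1) * (s * mellin (fractTail N) (-s)) with hg
  have hU : IsOpen {z : ℂ | 0 < z.re} := isOpen_lt continuous_const continuous_re
  have hgd : DifferentiableOn ℂ g {z : ℂ | 0 < z.re} := by
    intro z hz
    have h1 : DifferentiableAt ℂ (fun z => mellin (fractTail N) (-z)) z :=
      (differentiableAt_mellin_fractTail hN (s := -z) (by simpa using hz)).comp z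
        differentiableAt_id.neg
    have h2 : DifferentiableAt ℂ (fun z : ℂ => ∑ n ∈ Finset.Icc 1 N, (n : ℂ) ^ (-z)) z := by
      refine DifferentiableAt.fun_sum fun n hn => ?_
      have hn0 : (n : ℂ) ≠ 0 := by
        have := Finset.mem_Icc.1 hn
        exact_mod_cast (by omega : n ≠ 0)
      exact differentiableAt_id.neg.const_cpow (Or.inl hn0)
    have h3 : DifferentiableAt ℂ (fun z : ℂ => (N : ℂ) ^ (1 - z)) z :=
      ((differentiableAt_const 1).sub differentiableAt_id).const_cpow (Or.inl hN0)
    have h4 : DifferentiableAt ℂ (fun z : ℂ => z - 1) z := by fun_prop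
    exact (((h4.mul h2).add h3).sub (h4.mul (differentiableAt_id.mul h1))).differentiableWithinAt
  -- multiplied by `s - 1`, both sides are holomorphic on the whole half-plane
  have heq : EqOn zetaMulSub g {z : ℂ | 0 < z.re} := by
    refine (differentiable_zetaMulSub.differentiableOn.analyticOnNhd
      hU).eqOn_of_preconnected_of_eventuallyEq (hgd.analyticOnNhd hU)
      (convex_halfSpace_re_gt 0).isPreconnected (z₀ := 2) (by simp) ?_
    filter_upwards [(isOpen_lt continuous_const continuous_re).mem_nhds
      (by simp : (1 : ℝ) < (2 : ℂ).re)] with z hz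
    have hz1 : z ≠ 1 := by rintro rfl; simp at hz
    have hz2 : z - 1 ≠ 0 := sub_ne_zero.2 hz1
    rw [zetaMulSub_of_ne hz1, riemannZeta_eq_sum_add_of_one_lt hN hz]
    simp only [hg]
    field_simp
  have h := heq hs
  have hs2 : s - 1 ≠ 0 := sub_ne_zero.2 hs1
  rw [zetaMulSub_of_ne hs1] at h
  apply mul_left_cancel₀ hs2
  rw [h]
  simp only [hg]
  field_simp

/-- Near the line `re s = 1` the zeta function is `O(|t| ^ (1/20))`. -/
lemma exists_norm_riemannZeta_le : ∃ A : ℝ, 1 ≤ A ∧ ∀ s : ℂ, 39 / 40 ≤ s.re → s.re ≤ 3 →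
    1 / 2 ≤ |s.im| → ‖riemannZeta s‖ ≤ A * (|s.im| + 2) ^ (1 / 20 : ℝ) := by
  refine ⟨100, by norm_num, fun s h1 h3 ht => ?_⟩
  -- with `N` of size `|t|`, every term of the summation formula is `O(N ^ (1/20))`
  set N : ℕ := ⌊|s.im|⌋₊ + 1 with hN
  have hN1 : 1 ≤ N := by omega
  have hN1' : (1 : ℝ) ≤ N := by exact_mod_cast hN1
  have hN0 : (0 : ℝ) < N := by linarith
  have hNt : |s.im| ≤ N := by rw [hN]; push_cast; exact (Nat.lt_floor_add_one _).le
  have hNt' : (N : ℝ) ≤ |s.im| + 2 := by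
    rw [hN]; push_cast; linarith [Nat.floor_le (abs_nonneg s.im)]
  have hs1 : s ≠ 1 := by rintro rfl; norm_num at ht
  have hsre : 0 < s.re := by linarith
  set v : ℝ := (N : ℝ) ^ (1 / 40 : ℝ) with hv
  have hv1 : 1 ≤ v := Real.one_le_rpow hN1' (by norm_num)
  have hvv : v * v = (N : ℝ) ^ (1 / 20 : ℝ) := by
    rw [hv, ← Real.rpow_add hN0]; norm_num
  have hpow : (N : ℝ) ^ (1 - s.re) ≤ v := Real.rpow_le_rpow_of_exponent_le hN1' (by linarith)
  have hsum : ‖∑ n ∈ Finset.Icc 1 N, (n : ℂ) ^ (-s)‖ ≤ 41 * (v * v) := by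
    calc _ ≤ ∑ n ∈ Finset.Icc 1 N, v * (n : ℝ)⁻¹ := by
          refine norm_sum_le_of_le _ fun n hn => ?_
          have hn' := Finset.mem_Icc.1 hn
          have hn1 : (1 : ℝ) ≤ n := by exact_mod_cast hn'.1
          have hn0 : (0 : ℝ) < n := by linarith
          rw [norm_natCast_cpow_of_pos (by omega), neg_re]
          calc (n : ℝ) ^ (-s.re) ≤ (n : ℝ) ^ (1 / 40 - 1 : ℝ) :=
                Real.rpow_le_rpow_of_exponent_le hn1 (by linarith)
            _ = (n : ℝ) ^ (1 / 40 : ℝ) * (n : ℝ)⁻¹ := by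
                rw [Real.rpow_sub hn0, Real.rpow_one, div_eq_mul_inv]
            _ ≤ _ := by
                gcongr
                exact Real.rpow_le_rpow hn0.le (by exact_mod_cast hn'.2) (by norm_num)
      _ = v * (harmonic N : ℝ) := by
          rw [← Finset.mul_sum, harmonic_eq_sum_Icc]; push_cast; rfl
      _ ≤ v * (1 + Real.log N) := by gcongr; exact harmonic_le_one_add_log N
      _ ≤ v * (1 + v / (1 / 40)) := by
          gcongr; exact Real.log_le_rpow_div hN0.le (by norm_num)
      _ ≤ _ := by nlinarith
  have hmid : ‖(N : ℂ) ^ (1 - s) / (s - 1)‖ ≤ 2 * (v * v) := by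
    have h4 : 1 / 2 ≤ ‖s - 1‖ := ht.trans (by simpa using abs_im_le_norm (s - 1))
    rw [norm_div, norm_natCast_cpow_of_pos (by omega), sub_re, one_re,
      div_le_iff₀ (by linarith)]
    nlinarith
  have htail : ‖s * mellin (fractTail N) (-s)‖ ≤ 8 * (v * v) := by
    have h5 : ‖s‖ ≤ 4 * N := by
      have := norm_le_abs_re_add_abs_im s
      rw [abs_of_pos hsre] at this
      linarith
    have h6 := norm_mellin_fractTail_le hN1 hsre
    have h7 : (N : ℝ) ^ (-s.re) / s.re ≤ 2 * (N : ℝ) ^ (-s.re) := by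
      rw [div_le_iff₀ hsre]
      have : 0 ≤ (N : ℝ) ^ (-s.re) := by positivity
      nlinarith
    calc _ ≤ 4 * N * (2 * (N : ℝ) ^ (-s.re)) := by
          rw [norm_mul]; exact mul_le_mul h5 (h6.trans h7) (norm_nonneg _) (by positivity)
      _ = 8 * (N : ℝ) ^ (1 - s.re) := by
          rw [sub_eq_add_neg, Real.rpow_add hN0, Real.rpow_one]; ring
      _ ≤ _ := by nlinarith
  rw [riemannZeta_eq_sum_add hN1 hsre hs1]
  calc _ ≤ 41 * (v * v) + 2 * (v * v) + 8 * (v * v) :=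
        (norm_sub_le _ _).trans (add_le_add ((norm_add_le _ _).trans (add_le_add hsum hmid)) htail)
    _ ≤ 100 * (v * v) := by nlinarith
    _ ≤ _ := by rw [hvv]; gcongr

end

/-! ### A zero-free region -/

section

open Complex Filter Topology Set MeasureTheory

lemma two_mul_rpow_le {x p : ℝ} (hx : 0 ≤ x) (hp : p ≤ 1) : (2 * x) ^ p ≤ 2 * x ^ p := by
  rw [Real.mul_rpow (by norm_num) hx]
  gcongr
  calc (2 : ℝ) ^ p ≤ 2 ^ (1 : ℝ) := Real.rpow_le_rpow_of_exponent_le (by norm_num) hp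
    _ = 2 := Real.rpow_one 2

lemma rpow_abs_im_add_two_le {s z : ℂ} (h : |s.im| ≤ |z.im| + 1) :
    (|s.im| + 2) ^ (1 / 20 : ℝ) ≤ 2 * (|z.im| + 2) ^ (1 / 20 : ℝ) := by
  have h0 := abs_nonneg z.im
  have h1 : |s.im| + 2 ≤ 2 * (|z.im| + 2) := by linarith
  calc _ ≤ (2 * (|z.im| + 2)) ^ (1 / 20 : ℝ) :=
        Real.rpow_le_rpow (by positivity) h1 (by norm_num)
    _ ≤ _ := two_mul_rpow_le (by positivity) (by norm_num)

lemma one_le_rpow_abs_add_two (t : ℝ) : 1 ≤ (|t| + 2) ^ (1 / 20 : ℝ) :=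
  Real.one_le_rpow (by linarith [abs_nonneg t]) (by norm_num)

/-- A bound for `ζ` and, by Cauchy's estimate on discs of radius `1/80`, for `ζ'`. -/
lemma exists_norm_deriv_riemannZeta_le : ∃ A : ℝ, 1 ≤ A ∧ ∀ s : ℂ, 79 / 80 ≤ s.re → s.re ≤ 2 →
    1 ≤ |s.im| → ‖riemannZeta s‖ ≤ A * (|s.im| + 2) ^ (1 / 20 : ℝ) ∧
      ‖deriv riemannZeta s‖ ≤ A * (|s.im| + 2) ^ (1 / 20 : ℝ) := by
  obtain ⟨A, hA, h⟩ := exists_norm_riemannZeta_le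
  refine ⟨160 * A, by linarith, fun s h1 h2 ht => ⟨?_, ?_⟩⟩
  · refine (h s (by linarith) (by linarith) (by linarith)).trans ?_
    have := one_le_rpow_abs_add_two s.im
    gcongr
    linarith
  have hball : ∀ z ∈ Metric.closedBall s (1 / 80), 39 / 40 ≤ z.re ∧ z.re ≤ 3 ∧
      1 / 2 ≤ |z.im| ∧ |z.im| ≤ |s.im| + 1 := by
    intro z hz
    rw [Metric.mem_closedBall, dist_eq] at hz
    have hr := (abs_re_le_norm (z - s)).trans hz
    have hi := (abs_im_le_norm (z - s)).trans hz
    rw [sub_re, abs_le] at hr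
    rw [sub_im] at hi
    have h4 := abs_sub_abs_le_abs_sub z.im s.im
    have h5 := abs_sub_abs_le_abs_sub s.im z.im
    rw [abs_sub_comm] at h5
    refine ⟨?_, ?_, ?_, ?_⟩ <;> linarith
  have hd : DiffContOnCl ℂ riemannZeta (Metric.ball s (1 / 80)) := by
    refine DifferentiableOn.diffContOnCl fun z hz => ?_
    have hz' := hball z (Metric.closure_ball_subset_closedBall hz)
    refine (differentiableAt_riemannZeta ?_).differentiableWithinAt
    rintro rfl
    have := hz'.2.2.1
    norm_num at this
  have := norm_deriv_le_of_forall_mem_sphere_norm_le (C := A * (2 * (|s.im| + 2) ^ (1 / 20 : ℝ)))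
    (by norm_num) hd (fun z hz => by
      obtain ⟨a, b, c, d⟩ := hball z (Metric.sphere_subset_closedBall hz)
      exact (h z a b c).trans (mul_le_mul_of_nonneg_left (rpow_abs_im_add_two_le d) (by linarith)))
  refine this.trans (le_of_eq ?_)
  ring

lemma exists_norm_riemannZeta_one_add_le : ∃ K : ℝ, 1 ≤ K ∧ ∀ x : ℝ, 0 < x → x ≤ 1 →
    ‖riemannZeta (1 + x)‖ ≤ K / x := by
  obtain ⟨K, hK⟩ := (isCompact_closedBall (1 : ℂ) 1).exists_bound_of_continuousOn
    differentiable_zetaMulSub.continuous.continuousOn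
  refine ⟨max K 1, le_max_right _ _, fun x hx hx1 => ?_⟩
  have hxn : ‖(x : ℂ)‖ = x := by rw [norm_real, Real.norm_of_nonneg hx.le]
  have h := hK (1 + x) (by simp [hx1, abs_of_pos hx])
  have hx0 : (x : ℂ) ≠ 0 := by exact_mod_cast hx.ne'
  rw [zetaMulSub_of_ne (by simpa using hx0), add_sub_cancel_left, norm_mul, hxn] at h
  rw [le_div_iff₀ hx, mul_comm]
  exact h.trans (le_max_left _ _)

/-- The quantitative form of the `3-4-1` inequality: `|ζ(1+x+it)|^4 ≥ c x^3 |t|^(-1/20)`. -/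
lemma exists_le_norm_riemannZeta_one_add_pow : ∃ e : ℝ, 0 < e ∧ ∀ x t : ℝ, 0 < x → x ≤ 1 →
    1 ≤ |t| → e ^ 4 * x ^ 3 ≤ (|t| + 2) ^ (1 / 20 : ℝ) * ‖riemannZeta (1 + x + I * t)‖ ^ 4 := by
  obtain ⟨A, hA, hζ⟩ := exists_norm_riemannZeta_le
  obtain ⟨K, hK, hζ1⟩ := exists_norm_riemannZeta_one_add_le
  have hKA : 0 < K ^ 3 * (2 * A) := by positivity
  refine ⟨(1 / (K ^ 3 * (2 * A))) ^ (1 / 4 : ℝ), by positivity, fun x t hx hx1 ht => ?_⟩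
  have he : ((1 / (K ^ 3 * (2 * A))) ^ (1 / 4 : ℝ)) ^ 4 = 1 / (K ^ 3 * (2 * A)) := by
    rw [← Real.rpow_natCast, ← Real.rpow_mul (by positivity)]; norm_num
  rw [he]
  have h := DirichletCharacter.norm_LFunction_product_ge_one (1 : DirichletCharacter ℂ 1) hx t
  rw [DirichletCharacter.LFunctionTrivChar] at h
  simp only [DirichletCharacter.LFunction_modOne_eq, norm_mul, norm_pow] at h
  have h1 := hζ1 x hx hx1
  have h2 : ‖riemannZeta (1 + x + 2 * I * t)‖ ≤ A * (2 * (|t| + 2) ^ (1 / 20 : ℝ)) := by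
    have him : (1 + x + 2 * I * t : ℂ).im = 2 * t := by simp
    have hre : (1 + x + 2 * I * t : ℂ).re = 1 + x := by simp
    refine (hζ _ (by rw [hre]; linarith) (by rw [hre]; linarith) ?_).trans ?_
    · rw [him, abs_mul, abs_two]; linarith
    · rw [him, abs_mul, abs_two]
      gcongr
      calc _ ≤ (2 * (|t| + 2)) ^ (1 / 20 : ℝ) :=
            Real.rpow_le_rpow (by positivity) (by linarith) (by norm_num)
        _ ≤ _ := two_mul_rpow_le (by positivity) (by norm_num)
  set w := (|t| + 2) ^ (1 / 20 : ℝ)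
  set Y := ‖riemannZeta (1 + x + I * t)‖
  have h3 : 1 ≤ (K / x) ^ 3 * Y ^ 4 * (A * (2 * w)) := by
    refine h.trans ?_
    gcongr
  rw [div_mul_eq_mul_div, one_mul, div_le_iff₀ hKA]
  calc x ^ 3 = x ^ 3 * 1 := by ring
    _ ≤ x ^ 3 * ((K / x) ^ 3 * Y ^ 4 * (A * (2 * w))) := by gcongr
    _ = _ := by field_simp

/-- A zero-free region for `ζ` of power type, with a lower bound for `|ζ|` there. -/
lemma exists_le_norm_riemannZeta : ∃ c : ℝ, 0 < c ∧ c ≤ 1 / 80 ∧ ∀ s : ℂ, 1 ≤ |s.im| →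
    1 - c / ((|s.im| + 2) ^ (1 / 20 : ℝ)) ^ 5 ≤ s.re → s.re ≤ 2 →
    c / ((|s.im| + 2) ^ (1 / 20 : ℝ)) ^ 4 ≤ ‖riemannZeta s‖ := by
  obtain ⟨A, hA, hζ⟩ := exists_norm_deriv_riemannZeta_le
  obtain ⟨e, he, hlow⟩ := exists_le_norm_riemannZeta_one_add_pow
  -- `d` is so small that the loss `2 A x₀ w` in the mean value inequality below is at most half
  -- of the lower bound `e d³ / w⁴` at abscissa `1 + x₀`, where `x₀ = d⁴ / w⁵`
  set d : ℝ := min (e / (4 * A)) (1 / 3) with hd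
  have hd0 : 0 < d := lt_min (by positivity) (by norm_num)
  have hd1 : d ≤ 1 / 3 := min_le_right _ _
  have hde : 4 * A * d ≤ e := by
    have : d ≤ e / (4 * A) := min_le_left _ _
    rwa [le_div_iff₀' (by positivity)] at this
  have hd4 : d ^ 4 ≤ 1 / 80 := by
    calc d ^ 4 ≤ (1 / 3) ^ 4 := by gcongr
      _ ≤ 1 / 80 := by norm_num
  refine ⟨min (d ^ 4) (e * d ^ 3 / 2), lt_min (by positivity) (by positivity),
    (min_le_left _ _).trans hd4, fun s ht h1 h2 => ?_⟩
  set w := (|s.im| + 2) ^ (1 / 20 : ℝ) with hw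
  have hw1 : 1 ≤ w := one_le_rpow_abs_add_two s.im
  have hw0 : 0 < w := by linarith
  set x₀ := d ^ 4 / w ^ 5 with hx₀
  have hx₀0 : 0 < x₀ := by positivity
  have hx₀1 : x₀ ≤ 1 / 80 := by
    refine (div_le_self (by positivity) (one_le_pow₀ hw1)).trans hd4
  -- beyond the abscissa `1 + x₀` the `3-4-1` inequality suffices
  have hright : ∀ x : ℝ, x₀ ≤ x → x ≤ 1 →
      e * d ^ 3 / w ^ 4 ≤ ‖riemannZeta (1 + x + I * s.im)‖ := by
    intro x hx hx1
    refine le_of_pow_le_pow_left₀ (n := 4) (by norm_num) (norm_nonneg _) ?_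
    have h3 := hlow x s.im (hx₀0.trans_le hx) hx1 ht
    rw [← hw] at h3
    have h4 : e ^ 4 * x₀ ^ 3 ≤ w * ‖riemannZeta (1 + x + I * s.im)‖ ^ 4 := by
      refine le_trans ?_ h3
      gcongr
    rw [← mul_le_mul_iff_right₀ hw0]
    refine le_trans (le_of_eq ?_) h4
    rw [hx₀]
    field_simp
  have hmain : e * d ^ 3 / 2 / w ^ 4 ≤ ‖riemannZeta s‖ := by
    by_cases hs : 1 + x₀ ≤ s.re
    · have h5 := hright (s.re - 1) (by linarith) (by linarith)
      have h6 : (1 + ((s.re - 1 : ℝ) : ℂ) + I * s.im) = s := by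
        apply Complex.ext <;> simp
      rw [h6] at h5
      refine le_trans ?_ h5
      gcongr
      have : 0 < e * d ^ 3 := by positivity
      linarith
    · -- to the left of it, the bound is transported by the mean value inequality
      push Not at hs
      have h7 : 1 - x₀ ≤ s.re := by
        refine le_trans ?_ h1
        rw [hx₀]
        gcongr
        exact min_le_left _ _
      set z : ℂ := 1 + x₀ + I * s.im with hz
      have hzre : z.re = 1 + x₀ := by simp [hz]
      have hzim : z.im = s.im := by simp [hz]
      have h5 := hright x₀ le_rfl (by linarith)
      set S : Set ℂ := {y | 79 / 80 ≤ y.re ∧ y.re ≤ 2 ∧ y.im = s.im} with hS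
      have hconv : Convex ℝ S :=
        (convex_halfSpace_re_ge (79 / 80)).inter ((convex_halfSpace_re_le 2).inter
          (convex_hyperplane (f := Complex.im) ⟨add_im, fun c y => by simp⟩ s.im))
      have hdiff := hconv.norm_image_sub_le_of_norm_deriv_le (𝕜 := ℂ) (f := riemannZeta)
        (C := A * w) (x := s) (y := z) (fun y hy => differentiableAt_riemannZeta (by
          rintro rfl
          have := hy.2.2
          rw [one_im] at this
          rw [← this] at ht
          norm_num at ht)) (fun y hy => by
          have := (hζ y hy.1 hy.2.1 (by rw [hy.2.2]; exact ht)).2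
          rwa [hy.2.2] at this) ⟨by linarith, by linarith, rfl⟩
          ⟨by rw [hzre]; linarith, by rw [hzre]; linarith, hzim⟩
      have h8 : ‖z - s‖ ≤ 2 * x₀ := by
        have h9 : z - s = ((1 + x₀ - s.re : ℝ) : ℂ) := by
          apply Complex.ext <;> simp [hz]
        rw [h9, norm_real, Real.norm_of_nonneg (by linarith)]
        linarith
      have h10 : ‖riemannZeta z‖ - ‖riemannZeta s‖ ≤ A * w * (2 * x₀) :=
        (norm_sub_norm_le _ _).trans (hdiff.trans (by gcongr))
      have h11 : A * w * (2 * x₀) ≤ e * d ^ 3 / 2 / w ^ 4 := by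
        rw [hx₀, le_div_iff₀ (by positivity)]
        have h12 : A * w * (2 * (d ^ 4 / w ^ 5)) * w ^ 4 = (4 * A * d) * d ^ 3 / 2 := by
          field_simp
          ring
        rw [h12]
        gcongr
      have h13 : e * d ^ 3 / w ^ 4 = e * d ^ 3 / 2 / w ^ 4 + e * d ^ 3 / 2 / w ^ 4 := by ring
      linarith
  refine le_trans ?_ hmain
  gcongr
  exact min_le_right _ _

end

/-! ### The Dirichlet series of `Λ - 1` -/

section

open Complex Filter Topology Set MeasureTheory

/-- The holomorphic function `-ζ'/ζ - ζ`, continued across the cancelling poles at `s = 1`. -/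
noncomputable def zetaDiff (s : ℂ) : ℂ := -dslope zetaMulSub 1 s - logDeriv zetaMulSub s

lemma zetaDiff_eq {s : ℂ} (hs : s ≠ 1) (hζ : riemannZeta s ≠ 0) :
    zetaDiff s = -deriv riemannZeta s / riemannZeta s - riemannZeta s := by
  have hs1 : s - 1 ≠ 0 := sub_ne_zero.2 hs
  have h1 : logDeriv zetaMulSub s = 1 / (s - 1) + deriv riemannZeta s / riemannZeta s := by
    have heq : zetaMulSub =ᶠ[𝓝 s] fun z => (z - 1) * riemannZeta z := by
      filter_upwards [isOpen_ne.mem_nhds hs] with z hz using zetaMulSub_of_ne hz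
    have hd : HasDerivAt (fun z => (z - 1) * riemannZeta z)
        (1 * riemannZeta s + (s - 1) * deriv riemannZeta s) s :=
      ((hasDerivAt_id s).sub_const 1).mul (differentiableAt_riemannZeta hs).hasDerivAt
    rw [logDeriv_apply, heq.deriv_eq, hd.deriv, zetaMulSub_of_ne hs]
    field_simp
  have h2 : dslope zetaMulSub 1 s = riemannZeta s - 1 / (s - 1) := by
    rw [dslope_of_ne _ hs, slope_def_field, zetaMulSub_one, zetaMulSub_of_ne hs]
    field_simp
  rw [zetaDiff, h1, h2]
  ring

lemma differentiableAt_zetaDiff {s : ℂ} (hs : zetaMulSub s ≠ 0) :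
    DifferentiableAt ℂ zetaDiff s := by
  have h1 : DifferentiableAt ℂ (dslope zetaMulSub 1) s :=
    ((Complex.differentiableOn_dslope univ_mem).2
      differentiable_zetaMulSub.differentiableOn).differentiableAt univ_mem
  have h2 : DifferentiableAt ℂ (deriv zetaMulSub) s :=
    (differentiable_zetaMulSub.analyticAt s).deriv.differentiableAt
  exact h1.neg.sub (h2.div (differentiable_zetaMulSub s) hs)

lemma continuousAt_iteratedDeriv_zetaDiff {s : ℂ} (hs : zetaMulSub s ≠ 0) :
    ContinuousAt (iteratedDeriv 2 zetaDiff) s := by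
  have hU : IsOpen {z | zetaMulSub z ≠ 0} :=
    isOpen_ne.preimage differentiable_zetaMulSub.continuous
  have h : AnalyticAt ℂ zetaDiff s :=
    (show DifferentiableOn ℂ zetaDiff {z | zetaMulSub z ≠ 0} from
      fun z hz => (differentiableAt_zetaDiff hz).differentiableWithinAt).analyticAt
      (hU.mem_nhds hs)
  rw [iteratedDeriv_succ, iteratedDeriv_one]
  exact h.deriv.deriv.continuousAt

/-- The second derivative of `-ζ'/ζ - ζ` grows slower than `|t|` up to the line `re s = 1`, by
Cauchy's estimate on discs inside the zero-free region. -/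
lemma exists_norm_iteratedDeriv_zetaDiff_le : ∃ B : ℝ, 0 < B ∧ ∀ s : ℂ, 1 ≤ s.re → s.re ≤ 3 / 2 →
    ‖iteratedDeriv 2 zetaDiff s‖ ≤ B * (|s.im| + 2) ^ (3 / 4 : ℝ) := by
  obtain ⟨A, hA, hζ⟩ := exists_norm_deriv_riemannZeta_le
  obtain ⟨c, hc, hc1, hlow⟩ := exists_le_norm_riemannZeta
  obtain ⟨B₀, hB₀⟩ := ((isCompact_Icc (a := (1 : ℝ)) (b := 3 / 2)).reProdIm
    (isCompact_Icc (a := (-2 : ℝ)) (b := 2))).exists_bound_of_continuousOn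
    (f := iteratedDeriv 2 zetaDiff) fun z hz =>
      (continuousAt_iteratedDeriv_zetaDiff (zetaMulSub_ne_zero hz.1.1)).continuousWithinAt
  refine ⟨max B₀ (2 ^ 17 * A / c ^ 3), lt_max_of_lt_right (by positivity), fun s h1 h2 => ?_⟩
  have hτ : 1 ≤ (|s.im| + 2) ^ (3 / 4 : ℝ) :=
    Real.one_le_rpow (by linarith [abs_nonneg s.im]) (by norm_num)
  rcases le_total |s.im| 2 with ht | ht
  · have h3 := hB₀ s ⟨⟨h1, h2⟩, abs_le.1 ht⟩
    calc _ ≤ B₀ * 1 := by simpa using h3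
      _ ≤ _ := mul_le_mul (le_max_left _ _) hτ zero_le_one
        (le_max_of_le_right (by positivity))
  set w := (|s.im| + 2) ^ (1 / 20 : ℝ) with hw
  have hw1 : 1 ≤ w := one_le_rpow_abs_add_two s.im
  have hw15 : w ^ 15 = (|s.im| + 2) ^ (3 / 4 : ℝ) := by
    rw [hw, ← Real.rpow_natCast, ← Real.rpow_mul (by positivity)]; norm_num
  -- the factor `2` keeps the disc in the zero-free region, which narrows as `|t|` grows
  set r : ℝ := c / (2 * w) ^ 5 with hr
  have hr0 : 0 < r := by positivity
  have hr1 : r ≤ 1 / 80 := (div_le_self hc.le (one_le_pow₀ (by linarith))).trans hc1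
  have hball : ∀ z ∈ Metric.closedBall s r, z ≠ 1 ∧ riemannZeta z ≠ 0 ∧
      ‖zetaDiff z‖ ≤ 2 * A * (2 * w) ^ 5 / c := by
    intro z hz
    rw [Metric.mem_closedBall, dist_eq] at hz
    have hre := (abs_re_le_norm (z - s)).trans hz
    have him := (abs_im_le_norm (z - s)).trans hz
    rw [sub_re, abs_le] at hre
    rw [sub_im] at him
    have h4 := abs_sub_abs_le_abs_sub z.im s.im
    have h5 := abs_sub_abs_le_abs_sub s.im z.im
    rw [abs_sub_comm] at h5
    have hz1 : 1 ≤ |z.im| := by linarith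
    have hzne : z ≠ 1 := by rintro rfl; norm_num at hz1
    have hwz : (|z.im| + 2) ^ (1 / 20 : ℝ) ≤ 2 * w := rpow_abs_im_add_two_le (by linarith)
    set y := (|z.im| + 2) ^ (1 / 20 : ℝ) with hy
    have hy1 : 1 ≤ y := one_le_rpow_abs_add_two z.im
    have h6 : r ≤ c / y ^ 5 := by rw [hr]; gcongr
    have hl : c / y ^ 4 ≤ ‖riemannZeta z‖ := hlow z hz1 (by linarith) (by linarith)
    have hu := hζ z (by linarith) (by linarith) hz1
    rw [← hy] at hu
    have hpos : 0 < ‖riemannZeta z‖ := lt_of_lt_of_le (by positivity) hl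
    refine ⟨hzne, norm_pos_iff.1 hpos, ?_⟩
    rw [zetaDiff_eq hzne (norm_pos_iff.1 hpos)]
    have h7 : ‖-deriv riemannZeta z / riemannZeta z‖ ≤ A * (2 * w) ^ 5 / c := by
      rw [norm_div, norm_neg]
      calc _ ≤ A * y / (c / y ^ 4) := by gcongr; exact hu.2
        _ = A * y ^ 5 / c := by field_simp
        _ ≤ _ := by gcongr
    have h8 : ‖riemannZeta z‖ ≤ A * (2 * w) ^ 5 / c := by
      calc _ ≤ A * y := hu.1
        _ ≤ A * y ^ 5 / 1 := by
            rw [div_one]; gcongr; exact le_self_pow₀ hy1 (by norm_num)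
        _ ≤ _ := by gcongr; linarith
    calc _ ≤ _ := norm_sub_le _ _
      _ ≤ A * (2 * w) ^ 5 / c + A * (2 * w) ^ 5 / c := add_le_add h7 h8
      _ = _ := by ring
  have hd : DiffContOnCl ℂ zetaDiff (Metric.ball s r) := by
    refine DifferentiableOn.diffContOnCl fun z hz => ?_
    obtain ⟨hz1, hz2, -⟩ := hball z (Metric.closure_ball_subset_closedBall hz)
    refine (differentiableAt_zetaDiff ?_).differentiableWithinAt
    rw [zetaMulSub_of_ne hz1]
    exact mul_ne_zero (sub_ne_zero.2 hz1) hz2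
  have := norm_iteratedDeriv_le_of_forall_mem_sphere_norm_le 2 hr0 hd
    fun z hz => (hball z (Metric.sphere_subset_closedBall hz)).2.2
  refine this.trans ?_
  calc _ = 2 ^ 17 * A / c ^ 3 * w ^ 15 := by
        rw [hr]; norm_num [Nat.factorial]; field_simp; ring
    _ ≤ _ := by rw [hw15]; gcongr; exact le_max_right _ _

open scoped ArithmeticFunction.vonMangoldt

lemma abscissaOfAbsConv_vonMangoldt_sub_one_le :
    LSeries.abscissaOfAbsConv (fun n => (Λ n : ℂ) - 1) ≤ 1 := by
  refine LSeries.abscissaOfAbsConv_le_of_forall_lt_LSeriesSummable' fun y hy => ?_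
  have hy' : 1 < (y : ℂ).re := by exact_mod_cast hy
  exact (ArithmeticFunction.LSeriesSummable_vonMangoldt hy').sub (LSeriesSummable_one_iff.2 hy')

/-- Differentiating the Dirichlet series of `Λ - 1` twice multiplies the coefficients by `log²`. -/
lemma iteratedDeriv_zetaDiff {s : ℂ} (hs : 1 < s.re) : iteratedDeriv 2 zetaDiff s =
    LSeries (fun n => (Real.log n : ℂ) ^ 2 * ((Λ n : ℂ) - 1)) s := by
  have heq : zetaDiff =ᶠ[𝓝 s] LSeries (fun n => (Λ n : ℂ) - 1) := by
    filter_upwards [(isOpen_lt continuous_const continuous_re).mem_nhds hs] with z hz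
    have hz' : 1 < z.re := hz
    rw [zetaDiff_eq (by rintro rfl; simp at hz') (riemannZeta_ne_zero_of_one_lt_re hz'),
      ← ArithmeticFunction.LSeries_vonMangoldt_eq_deriv_riemannZeta_div hz',
      ← LSeries_one_eq_riemannZeta hz']
    exact (LSeries_sub (ArithmeticFunction.LSeriesSummable_vonMangoldt hz')
      (LSeriesSummable_one_iff.2 hz')).symm
  rw [heq.iteratedDeriv_eq, LSeries_iteratedDeriv]
  · simp only [even_two, Even.neg_pow, one_pow, one_mul]
    congr 1
    ext n
    simp [LSeries.logMul, ofReal_log]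
    ring
  · exact abscissaOfAbsConv_vonMangoldt_sub_one_le.trans_lt (by exact_mod_cast hs)

lemma LSeriesSummable_log_sq_mul {s : ℂ} (hs : 1 < s.re) :
    LSeriesSummable (fun n => (Real.log n : ℂ) ^ 2 * ((Λ n : ℂ) - 1)) s := by
  have h : LSeriesSummable (LSeries.logMul^[2] fun n => (Λ n : ℂ) - 1) s := by
    refine LSeriesSummable_of_abscissaOfAbsConv_lt_re ?_
    rw [LSeries.absicssaOfAbsConv_logPowMul]
    exact abscissaOfAbsConv_vonMangoldt_sub_one_le.trans_lt (by exact_mod_cast hs)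
  convert! h using 2 with n
  simp [LSeries.logMul, ofReal_log]
  ring

end

/-! ### Riesz means by Mellin inversion -/

section

open Complex Filter Topology Set MeasureTheory
open scoped ArithmeticFunction.vonMangoldt

/-- The Riesz weight: `1 - t` on `(0, 1]`, and `0` elsewhere. -/
noncomputable def rieszWeight (t : ℝ) : ℂ :=
  (Ioc 0 1).indicator (fun _ => 1 : ℝ → ℂ) t -
    (Ioc 0 1).indicator (fun t => (t : ℂ) ^ (1 : ℂ) : ℝ → ℂ) t

lemma rieszWeight_of_pos {t : ℝ} (ht : 0 < t) : rieszWeight t = ((max (1 - t) 0 : ℝ) : ℂ) := by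
  rw [rieszWeight]
  by_cases h : t ≤ 1
  · rw [indicator_of_mem (show t ∈ Ioc (0 : ℝ) 1 from ⟨ht, h⟩),
      indicator_of_mem (show t ∈ Ioc (0 : ℝ) 1 from ⟨ht, h⟩), max_eq_left (by linarith), cpow_one]
    push_cast; rfl
  · rw [indicator_of_notMem (fun h' => h h'.2), indicator_of_notMem (fun h' => h h'.2),
      max_eq_right (by linarith)]
    simp

lemma hasMellin_rieszWeight {s : ℂ} (hs : 0 < s.re) :
    HasMellin rieszWeight s (1 / s - 1 / (s + 1)) := by
  have h1 := hasMellin_one_Ioc hs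
  have h2 := hasMellin_cpow_Ioc 1 (s := s) (by simp; linarith)
  have h := hasMellin_sub h1.1 h2.1
  rw [h1.2, h2.2] at h
  exact h

lemma norm_mellin_rieszWeight_le {σ : ℝ} (hσ : 1 ≤ σ) (y : ℝ) :
    ‖mellin rieszWeight (σ + y * I)‖ ≤ (1 + y ^ 2)⁻¹ := by
  have hre : (σ + y * I : ℂ).re = σ := by simp
  have him : (σ + y * I : ℂ).im = y := by simp
  rw [(hasMellin_rieszWeight (by rw [hre]; linarith)).2]
  set s : ℂ := σ + y * I with hs
  have hs0 : s ≠ 0 := by intro h; rw [h] at hre; simp at hre; linarith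
  have hs1 : s + 1 ≠ 0 := by
    intro h
    have h1 := congrArg re h
    rw [add_re, hre, one_re, zero_re] at h1
    linarith
  have h0 : 1 / s - 1 / (s + 1) = (s * (s + 1))⁻¹ := by field_simp; ring
  have hn1 : 1 + y ^ 2 ≤ ‖s‖ ^ 2 := by
    rw [Complex.sq_norm, normSq_apply, hre, him]; nlinarith
  have hn2 : ‖s‖ ^ 2 ≤ ‖s + 1‖ ^ 2 := by
    have hre' : (s + 1).re = σ + 1 := by rw [add_re, hre, one_re]
    have him' : (s + 1).im = y := by rw [add_im, him, one_im, add_zero]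
    rw [Complex.sq_norm, Complex.sq_norm, normSq_apply, normSq_apply, hre', him', hre, him]
    nlinarith
  have hn3 : ‖s‖ ≤ ‖s + 1‖ := le_of_sq_le_sq hn2 (norm_nonneg _)
  rw [h0, norm_inv, norm_mul]
  gcongr
  nlinarith [norm_nonneg s]

lemma integrable_mellin_rieszWeight {σ : ℝ} (hσ : 1 ≤ σ) :
    Integrable fun y : ℝ => mellin rieszWeight (σ + y * I) := by
  have hre : ∀ y : ℝ, (σ + y * I : ℂ).re = σ := by simp
  have heq : (fun y : ℝ => mellin rieszWeight (σ + y * I)) =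
      fun y : ℝ => 1 / (σ + y * I : ℂ) - 1 / (σ + y * I + 1) := by
    ext y
    exact (hasMellin_rieszWeight (by rw [hre]; linarith)).2
  refine integrable_inv_one_add_sq.mono' ?_ (Eventually.of_forall (norm_mellin_rieszWeight_le hσ))
  rw [heq]
  refine Continuous.aestronglyMeasurable ?_
  refine Continuous.sub (continuous_const.div (by fun_prop) fun y h => ?_)
    (continuous_const.div (by fun_prop) fun y h => ?_)
  · have := congrArg re h; simp at this; linarith
  · have := congrArg re h; simp at this; linarith

/-- Mellin inversion for the Riesz weight. -/
lemma integral_cpow_mul_mellin_rieszWeight {σ : ℝ} (hσ : 1 ≤ σ) {x : ℝ} (hx : 0 < x) :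
    ∫ y : ℝ, (x : ℂ) ^ (-(σ + y * I)) * mellin rieszWeight (σ + y * I) =
      2 * Real.pi * ((max (1 - x) 0 : ℝ) : ℂ) := by
  have hc : ContinuousAt rieszWeight x := by
    have : (fun t : ℝ => ((max (1 - t) 0 : ℝ) : ℂ)) =ᶠ[𝓝 x] rieszWeight := by
      filter_upwards [Ioi_mem_nhds hx] with t ht using (rieszWeight_of_pos ht).symm
    refine ContinuousAt.congr ?_ this
    fun_prop
  have h := mellinInv_mellin_eq σ rieszWeight hx
    (hasMellin_rieszWeight (by rw [ofReal_re]; linarith)).1 (integrable_mellin_rieszWeight hσ) hc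
  rw [rieszWeight_of_pos hx, mellinInv] at h
  rw [← h]
  simp only [smul_eq_mul, real_smul]
  push_cast
  have hπ : (Real.pi : ℂ) ≠ 0 := by exact_mod_cast Real.pi_ne_zero
  rw [← mul_assoc, mul_one_div_cancel (mul_ne_zero two_ne_zero hπ), one_mul]

lemma integrable_one_add_abs_rpow : Integrable fun y : ℝ => (1 + |y|) ^ (-(5 / 4) : ℝ) := by
  have := integrable_one_add_norm (E := ℝ) (μ := volume) (r := 5 / 4) (by norm_num)
  simpa using this

/-- The Riesz sum of `log² n (Λ(n) - 1)` is `O(N²)`. Without the factor `log²`, which comes from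
differentiating the generating series twice, this order of magnitude would be trivial. -/
lemma exists_abs_sum_riesz_le : ∃ K : ℝ, 0 < K ∧ ∀ N : ℕ, 1 ≤ N →
    |∑ n ∈ Finset.Icc 1 N, Real.log n ^ 2 * (Λ n - 1) * ((N : ℝ) - n)| ≤ K * (N : ℝ) ^ 2 := by
  obtain ⟨B, hB, hF⟩ := exists_norm_iteratedDeriv_zetaDiff_le
  set J : ℝ := ∫ y : ℝ, 4 * B * (1 + |y|) ^ (-(5 / 4) : ℝ) with hJ
  have hJ0 : 0 ≤ J := integral_nonneg fun y => by positivity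
  refine ⟨Real.exp 1 * J + 1, by positivity, fun N hN => ?_⟩
  rcases eq_or_lt_of_le hN with rfl | hN2
  · simp; positivity
  have hN0 : (0 : ℝ) < N := by exact_mod_cast hN
  have hNC : (N : ℂ) ≠ 0 := by exact_mod_cast hN0.ne'
  have hlog : 1 / 2 ≤ Real.log N := by
    have h2 : Real.log 2 ≤ Real.log N := Real.log_le_log (by norm_num) (by exact_mod_cast hN2)
    linarith [Real.log_two_gt_d9]
  -- on this line `N ^ σ` is still `O(N)`
  set σ : ℝ := 1 + 1 / (4 * Real.log N) with hσ
  have hσ1 : 1 < σ := by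
    have : 0 < 1 / (4 * Real.log N) := by positivity
    linarith
  have hσ2 : σ ≤ 3 / 2 := by
    have : 1 / (4 * Real.log N) ≤ 1 / 2 := by
      rw [div_le_div_iff₀ (by positivity) (by norm_num)]; linarith
    linarith
  have hNσ : (N : ℝ) ^ σ ≤ Real.exp 1 * N := by
    rw [Real.rpow_def_of_pos hN0, hσ, mul_add, Real.exp_add, mul_one, Real.exp_log hN0, mul_comm]
    gcongr
    rw [mul_one_div, div_le_one (by positivity)]
    linarith
  set b : ℕ → ℂ := fun n => (Real.log n : ℂ) ^ 2 * ((Λ n : ℂ) - 1) with hb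
  set k : ℝ → ℂ := fun y => mellin rieszWeight (σ + y * I) with hk
  have hre : ∀ y : ℝ, (σ + y * I : ℂ).re = σ := by simp
  have him : ∀ y : ℝ, (σ + y * I : ℂ).im = y := by simp
  have hkI : Integrable k := integrable_mellin_rieszWeight hσ1.le
  set G : ℕ → ℝ → ℂ := fun n y =>
    LSeries.term b (σ + y * I) n * ((N : ℂ) ^ (σ + y * I : ℂ) * k y) with hG
  have hNn : ∀ y : ℝ, ‖(N : ℂ) ^ (σ + y * I : ℂ)‖ = (N : ℝ) ^ σ := by
    intro y
    rw [norm_natCast_cpow_of_pos (by omega), hre]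
  have hGn : ∀ n y, ‖G n y‖ = ‖LSeries.term b (σ : ℂ) n‖ * ((N : ℝ) ^ σ * ‖k y‖) := by
    intro n y
    rw [hG]
    simp only [norm_mul, hNn]
    congr 1
    rw [LSeries.norm_term_eq, LSeries.norm_term_eq, hre, ofReal_re]
  have hcont : ∀ n : ℕ, n ≠ 0 → Continuous fun y : ℝ => (n : ℂ) ^ (σ + y * I : ℂ) := by
    intro n hn
    have : (n : ℂ) ≠ 0 := by exact_mod_cast hn
    exact (by fun_prop : Continuous fun y : ℝ => (σ + y * I : ℂ)).const_cpow (Or.inl this)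
  have hGI : ∀ n, Integrable (G n) := by
    intro n
    refine (hkI.norm.const_mul (‖LSeries.term b (σ : ℂ) n‖ * (N : ℝ) ^ σ)).mono' ?_
      (Eventually.of_forall fun y => by rw [hGn, mul_assoc])
    refine AEStronglyMeasurable.mul ?_
      ((hcont N (by omega)).aestronglyMeasurable.mul hkI.aestronglyMeasurable)
    rcases eq_or_ne n 0 with rfl | hn
    · simpa using aestronglyMeasurable_const
    · simp only [LSeries.term_of_ne_zero hn]
      refine (continuous_const.div (hcont n hn) fun y => ?_).aestronglyMeasurable
      exact (cpow_ne_zero_iff_of_exponent_ne_zero (fun h => by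
        have := congrArg re h
        rw [hre, zero_re] at this
        linarith)).2 (by exact_mod_cast hn)
  have hGS : Summable fun n => ∫ y, ‖G n y‖ := by
    simp_rw [hGn, integral_const_mul]
    exact (LSeriesSummable_log_sq_mul (s := (σ : ℂ)) (by simpa using hσ1)).norm.mul_right _
  have hsum := hasSum_integral_of_summable_integral_norm hGI hGS
  have hinner : ∀ y : ℝ, ∑' n, G n y =
      iteratedDeriv 2 zetaDiff (σ + y * I) * ((N : ℂ) ^ (σ + y * I : ℂ) * k y) := by
    intro y
    rw [iteratedDeriv_zetaDiff (by rw [hre]; exact hσ1), LSeries, ← tsum_mul_right]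
  have hbound : ‖∫ y, ∑' n, G n y‖ ≤ Real.exp 1 * N * J := by
    rw [hJ, ← integral_const_mul]
    refine norm_integral_le_of_norm_le
      ((integrable_one_add_abs_rpow.const_mul _).const_mul _) (Eventually.of_forall fun y => ?_)
    rw [hinner, norm_mul, norm_mul, hNn]
    have h1 := hF (σ + y * I) (by rw [hre]; exact hσ1.le) (by rw [hre]; exact hσ2)
    rw [him] at h1
    have h2 : ‖k y‖ ≤ (1 + y ^ 2)⁻¹ := norm_mellin_rieszWeight_le hσ1.le y
    have hy := abs_nonneg y
    have h3 : (|y| + 2) ^ (3 / 4 : ℝ) ≤ 2 * (1 + |y|) ^ (3 / 4 : ℝ) := by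
      calc _ ≤ (2 * (1 + |y|)) ^ (3 / 4 : ℝ) :=
            Real.rpow_le_rpow (by positivity) (by linarith) (by norm_num)
        _ ≤ _ := two_mul_rpow_le (by positivity) (by norm_num)
    have h4 : (1 + y ^ 2)⁻¹ ≤ 2 * ((1 + |y|) ^ 2)⁻¹ := by
      rw [← div_eq_mul_inv, inv_eq_one_div, div_le_div_iff₀ (by positivity) (by positivity)]
      nlinarith [sq_abs y, sq_nonneg (|y| - 1)]
    have h5 : (1 + |y|) ^ (-(5 / 4) : ℝ) = (1 + |y|) ^ (3 / 4 : ℝ) * ((1 + |y|) ^ 2)⁻¹ := by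
      rw [← Real.rpow_natCast, ← Real.rpow_neg (by positivity), ← Real.rpow_add (by positivity)]
      norm_num
    calc _ ≤ B * (2 * (1 + |y|) ^ (3 / 4 : ℝ)) *
          (Real.exp 1 * N * (2 * ((1 + |y|) ^ 2)⁻¹)) := by
          gcongr
          · exact h1.trans (by gcongr)
          · exact h2.trans h4
      _ = _ := by rw [h5]; ring
  have hterm : ∀ n, ∫ y, G n y = 2 * Real.pi * (b n * ((max (1 - (n : ℝ) / N) 0 : ℝ) : ℂ)) := by
    intro n
    rcases eq_or_ne n 0 with rfl | hn
    · simp [hG, hb]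
    have hn0 : (0 : ℝ) < n := by exact_mod_cast Nat.pos_of_ne_zero hn
    rw [mul_left_comm, ← integral_cpow_mul_mellin_rieszWeight hσ1.le (div_pos hn0 hN0),
      ← integral_const_mul]
    refine integral_congr_ae (Eventually.of_forall fun y => ?_)
    simp only [hG, LSeries.term_of_ne_zero hn]
    rw [ofReal_div, div_cpow_ofReal_nonneg hn0.le hN0.le]
    simp only [ofReal_natCast, cpow_neg, hk]
    field_simp
  have hfin : ∫ y, ∑' n, G n y =
      ∑ n ∈ Finset.Icc 1 N, 2 * Real.pi * (b n * ((max (1 - (n : ℝ) / N) 0 : ℝ) : ℂ)) := by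
    rw [← hsum.tsum_eq, tsum_congr hterm]
    refine tsum_eq_sum fun n hn => ?_
    rcases eq_or_ne n 0 with rfl | hn0
    · simp [hb]
    have hlt : N ≤ n := by
      by_contra h
      exact hn (Finset.mem_Icc.2 ⟨by omega, by omega⟩)
    have h1 : (1 : ℝ) ≤ n / N := by
      rw [le_div_iff₀ hN0, one_mul]; exact_mod_cast hlt
    rw [max_eq_right (by linarith)]
    simp
  have hreal : ∑ n ∈ Finset.Icc 1 N, 2 * Real.pi * (b n * ((max (1 - (n : ℝ) / N) 0 : ℝ) : ℂ)) =
      ((2 * Real.pi / N *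
        ∑ n ∈ Finset.Icc 1 N, Real.log n ^ 2 * (Λ n - 1) * ((N : ℝ) - n) : ℝ) : ℂ) := by
    rw [Finset.mul_sum, ofReal_sum]
    refine Finset.sum_congr rfl fun n hn => ?_
    have h1 : (n : ℝ) / N ≤ 1 := by
      rw [div_le_one hN0]; exact_mod_cast (Finset.mem_Icc.1 hn).2
    rw [max_eq_left (by linarith), hb]
    push_cast
    field_simp
  rw [hfin, hreal, norm_real, Real.norm_eq_abs, abs_mul, abs_of_pos (by positivity)] at hbound
  set T := |∑ n ∈ Finset.Icc 1 N, Real.log n ^ 2 * (Λ n - 1) * ((N : ℝ) - n)|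
  have hT : 0 ≤ T := abs_nonneg _
  rw [div_mul_eq_mul_div, div_le_iff₀ hN0] at hbound
  nlinarith [Real.pi_gt_three, sq_nonneg (N : ℝ)]

end

/-! ### From Riesz means to the prime number theorem -/

section

open scoped ArithmeticFunction.vonMangoldt
open Finset

lemma sum_vonMangoldt_le (N : ℕ) : ∑ n ∈ Icc 1 N, Λ n ≤ (Real.log 4 + 4) * N := by
  have h := Chebyshev.psi_le_const_mul_self (x := N) (Nat.cast_nonneg N)
  have : Chebyshev.psi N = ∑ n ∈ Icc 1 N, Λ n := by
    rw [Chebyshev.psi, Nat.floor_natCast]; rfl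
  rwa [this] at h

/-- A consequence of Chebyshev's bound, by induction on `N`: passing from `N` to `N + 1` adds
`(ψ(N) + N) log(1 + 1/N)`. -/
lemma sum_vonMangoldt_add_one_mul_log_sub_le {N : ℕ} (hN : 1 ≤ N) :
    ∑ n ∈ Icc 1 N, (Λ n + 1) * (Real.log N - Real.log n) ≤ (Real.log 4 + 5) * N := by
  have h4 : 0 ≤ Real.log 4 := Real.log_nonneg (by norm_num)
  induction N, hN using Nat.le_induction with
  | base => simp; positivity
  | succ N hN ih =>
    have hN0 : (0 : ℝ) < N := by exact_mod_cast hN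
    have hstep : ∑ n ∈ Icc 1 (N + 1), (Λ n + 1) * (Real.log (N + 1 : ℕ) - Real.log n) =
        ∑ n ∈ Icc 1 N, (Λ n + 1) * (Real.log N - Real.log n) +
          (∑ n ∈ Icc 1 N, Λ n + N) * (Real.log (N + 1 : ℕ) - Real.log N) := by
      rw [sum_Icc_succ_top (by omega), sub_self, mul_zero, add_zero]
      have : ∑ n ∈ Icc 1 N, Λ n + (N : ℝ) = ∑ n ∈ Icc 1 N, (Λ n + 1) := by
        rw [sum_add_distrib]; simp
      rw [this, sum_mul, ← sum_add_distrib]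
      exact sum_congr rfl fun n _ => by ring
    have hlog : Real.log (N + 1 : ℕ) - Real.log N ≤ 1 / N := by
      rw [← Real.log_div (by positivity) hN0.ne']
      refine (Real.log_le_sub_one_of_pos (by positivity)).trans (le_of_eq ?_)
      push_cast
      field_simp
      ring
    have hmul : (∑ n ∈ Icc 1 N, Λ n + N) * (Real.log (N + 1 : ℕ) - Real.log N) ≤
        Real.log 4 + 5 := by
      calc _ ≤ ((Real.log 4 + 4) * N + N) * (1 / N) := by
            refine mul_le_mul (by linarith [sum_vonMangoldt_le N]) hlog ?_ (by positivity)
            exact sub_nonneg.2 (Real.log_le_log hN0 (by push_cast; linarith))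
        _ = _ := by field_simp; ring
    rw [hstep, Nat.cast_add_one N, mul_add, mul_one]
    rw [Nat.cast_add_one N] at hmul
    exact add_le_add ih hmul

/-- First differences of the Riesz sum recover the partial sum `∑ b n`, up to the lower bound for
`b` on a short interval on either side. -/
lemma mul_abs_sum_le_of_riesz {b : ℕ → ℝ} {K R : ℝ} {N h : ℕ} (hh : h ≤ N)
    (hR : 0 ≤ R) (hb : ∀ n ∈ Icc 1 (N + h), -R ≤ b n)
    (hT : ∀ m ≤ N + h, |∑ n ∈ Icc 1 m, b n * ((m : ℝ) - n)| ≤ K * (m : ℝ) ^ 2) :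
    h * |∑ n ∈ Icc 1 N, b n| ≤ 5 * K * (N : ℝ) ^ 2 + (h : ℝ) ^ 2 * R := by
  have hK : 0 ≤ K * (N : ℝ) ^ 2 := (abs_nonneg _).trans (hT N (by omega))
  have hhN : (h : ℝ) ≤ N := by exact_mod_cast hh
  have hh0 : (0 : ℝ) ≤ h := Nat.cast_nonneg h
  have hsplit : ∀ (f : ℕ → ℝ) (m k : ℕ),
      ∑ n ∈ Icc 1 (m + k), f n = ∑ n ∈ Icc 1 m, f n + ∑ n ∈ Ioc m (m + k), f n := by
    intro f m k
    rw [← Icc_add_one_left_eq_Ioc]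
    have h1 : Icc 1 (m + k) = Ioc 0 (m + k) := rfl
    have h2 : Icc 1 m = Ioc 0 m := rfl
    rw [h1, h2, Icc_add_one_left_eq_Ioc, sum_Ioc_consecutive _ (Nat.zero_le _) (by omega)]
  -- on a short interval, the weights are between `0` and `h`
  have hshort : ∀ (m : ℕ) (c : ℕ → ℝ), m + h ≤ N + h → (∀ n ∈ Ioc m (m + h), 0 ≤ c n ∧ c n ≤ h) →
      -((h : ℝ) ^ 2 * R) ≤ ∑ n ∈ Ioc m (m + h), b n * c n := by
    intro m c hm hc
    calc -((h : ℝ) ^ 2 * R) = ∑ n ∈ Ioc m (m + h), -(R * h) := by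
          rw [sum_const, Nat.card_Ioc, nsmul_eq_mul]
          push_cast [Nat.add_sub_cancel_left]
          ring
      _ ≤ _ := by
          refine sum_le_sum fun n hn => ?_
          have h1 := hc n hn
          have h2 := mem_Ioc.1 hn
          have h3 := hb n (mem_Icc.2 ⟨by omega, by omega⟩)
          nlinarith [mul_nonneg hR h1.1, mul_nonneg hR (sub_nonneg.2 h1.2)]
  have hup : h * ∑ n ∈ Icc 1 N, b n ≤ 5 * K * (N : ℝ) ^ 2 + (h : ℝ) ^ 2 * R := by
    have h1 := (abs_le.1 (hT (N + h) le_rfl)).2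
    have h2 := (abs_le.1 (hT N (by omega))).1
    have h3 := hshort N (fun n => ((N + h : ℕ) : ℝ) - n) le_rfl fun n hn => by
      have h4 := mem_Ioc.1 hn
      have h5 : (N : ℝ) ≤ n := by exact_mod_cast h4.1.le
      have h6 : (n : ℝ) ≤ (N + h : ℕ) := by exact_mod_cast h4.2
      refine ⟨by linarith, ?_⟩
      push_cast at h6 ⊢
      linarith
    rw [hsplit] at h1
    have h7 : ∑ n ∈ Icc 1 N, b n * (((N + h : ℕ) : ℝ) - n) =
        ∑ n ∈ Icc 1 N, b n * ((N : ℝ) - n) + h * ∑ n ∈ Icc 1 N, b n := by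
      rw [mul_sum, ← sum_add_distrib]
      exact sum_congr rfl fun n _ => by push_cast; ring
    have h8 : K * ((N + h : ℕ) : ℝ) ^ 2 ≤ 4 * (K * (N : ℝ) ^ 2) := by
      rcases Nat.eq_zero_or_pos N with rfl | hN
      · have : h = 0 := by omega
        simp [this]
      · have hK' : 0 ≤ K := by
          have : (0 : ℝ) < (N : ℝ) ^ 2 := by positivity
          exact nonneg_of_mul_nonneg_left hK this
        push_cast
        have : ((N : ℝ) + h) ^ 2 ≤ 4 * (N : ℝ) ^ 2 := by nlinarith
        nlinarith
    linarith
  have hlo : -(5 * K * (N : ℝ) ^ 2 + (h : ℝ) ^ 2 * R) ≤ h * ∑ n ∈ Icc 1 N, b n := by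
    obtain ⟨m, rfl⟩ : ∃ m, N = m + h := ⟨N - h, by omega⟩
    have h1 := (abs_le.1 (hT (m + h) (by omega))).1
    have h2 := (abs_le.1 (hT m (by omega))).2
    have h3 := hshort m (fun n => (n : ℝ) - m) (by omega) fun n hn => by
      have h4 := mem_Ioc.1 hn
      have h5 : (m : ℝ) ≤ n := by exact_mod_cast h4.1.le
      have h6 : (n : ℝ) ≤ (m + h : ℕ) := by exact_mod_cast h4.2
      refine ⟨by linarith, ?_⟩
      push_cast at h6
      linarith
    have h7 : ∑ n ∈ Icc 1 (m + h), b n * (((m + h : ℕ) : ℝ) - n) =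
        h * ∑ n ∈ Icc 1 (m + h), b n + ∑ n ∈ Icc 1 m, b n * ((m : ℝ) - n) -
          ∑ n ∈ Ioc m (m + h), b n * ((n : ℝ) - m) := by
      rw [hsplit, hsplit b, mul_add, mul_sum, mul_sum]
      have h8 : ∑ n ∈ Icc 1 m, b n * (((m + h : ℕ) : ℝ) - n) =
          ∑ n ∈ Icc 1 m, h * b n + ∑ n ∈ Icc 1 m, b n * ((m : ℝ) - n) := by
        rw [← sum_add_distrib]
        exact sum_congr rfl fun n _ => by push_cast; ring
      have h9 : ∑ n ∈ Ioc m (m + h), b n * (((m + h : ℕ) : ℝ) - n) =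
          ∑ n ∈ Ioc m (m + h), h * b n - ∑ n ∈ Ioc m (m + h), b n * ((n : ℝ) - m) := by
        rw [← sum_sub_distrib]
        exact sum_congr rfl fun n _ => by push_cast; ring
      rw [h8, h9]
      ring
    have h8 : K * (m : ℝ) ^ 2 ≤ K * ((m + h : ℕ) : ℝ) ^ 2 := by
      rcases Nat.eq_zero_or_pos (m + h) with h0 | hN
      · have h0' : m = 0 := by omega
        have h0'' : h = 0 := by omega
        simp [h0', h0'']
      · have hK' : 0 ≤ K := by
          have : (0 : ℝ) < ((m + h : ℕ) : ℝ) ^ 2 := by positivity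
          exact nonneg_of_mul_nonneg_left hK this
        gcongr
        omega
    linarith
  calc h * |∑ n ∈ Icc 1 N, b n| = |h * ∑ n ∈ Icc 1 N, b n| := by rw [abs_mul, abs_of_nonneg hh0]
    _ ≤ _ := abs_le.2 ⟨hlo, hup⟩

/-- The Tauberian step: the Riesz mean bound `O(N²)` is differenced over an interval of length
about `N / log N`, using `Λ ≥ 0`. -/
lemma exists_abs_sum_log_sq_le : ∃ K : ℝ, 0 < K ∧ ∀ N : ℕ, 2 ≤ N →
    |∑ n ∈ Icc 1 N, Real.log n ^ 2 * (Λ n - 1)| ≤ K * N * Real.log N := by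
  obtain ⟨K, hK, hT⟩ := exists_abs_sum_riesz_le
  refine ⟨10 * K + 6, by positivity, fun N hN => ?_⟩
  have hN2 : (2 : ℝ) ≤ N := by exact_mod_cast hN
  have hN0 : (0 : ℝ) < N := by linarith
  set L := Real.log N with hL
  have hL1 : 1 / 2 ≤ L := by
    have h2 : Real.log 2 ≤ L := Real.log_le_log (by norm_num) hN2
    linarith [Real.log_two_gt_d9]
  have hLN : L ≤ N := (Real.log_le_sub_one_of_pos hN0).trans (by linarith)
  -- the length of the short interval balances the two error terms
  set h : ℕ := ⌈(N : ℝ) / (2 * L)⌉₊ with hh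
  have hq : 1 / 2 ≤ (N : ℝ) / (2 * L) := by
    rw [div_le_div_iff₀ (by norm_num) (by positivity)]; linarith
  have hlow : (N : ℝ) / (2 * L) ≤ h := Nat.le_ceil _
  have hhi : (h : ℝ) ≤ 3 * ((N : ℝ) / (2 * L)) := by
    linarith [(Nat.ceil_lt_add_one (by linarith : (0 : ℝ) ≤ (N : ℝ) / (2 * L))).le]
  have hhN : h ≤ N := by
    refine Nat.ceil_le.2 (div_le_self hN0.le (by linarith))
  have hh0 : (0 : ℝ) < h := by linarith
  have key := mul_abs_sum_le_of_riesz (b := fun n => Real.log n ^ 2 * (Λ n - 1)) (K := K)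
    (R := 4 * L ^ 2) hhN (by positivity) (fun n hn => ?_) (fun m _ => ?_)
  · have h1 : h * (5 * K * (N : ℝ) * (2 * L)) ≥ 5 * K * (N : ℝ) ^ 2 := by
      have h2 : (N : ℝ) ≤ h * (2 * L) := by rwa [div_le_iff₀ (by positivity)] at hlow
      calc 5 * K * (N : ℝ) ^ 2 = 5 * K * N * N := by ring
        _ ≤ 5 * K * N * (h * (2 * L)) := by gcongr
        _ = _ := by ring
    have h3 : (h : ℝ) ^ 2 * (4 * L ^ 2) ≤ h * (6 * N * L) := by
      have h4 : (h : ℝ) * (2 * L) ≤ 3 * N := by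
        rw [← mul_div_assoc, le_div_iff₀ (by positivity)] at hhi; exact hhi
      calc (h : ℝ) ^ 2 * (4 * L ^ 2) = h * (h * (2 * L)) * (2 * L) := by ring
        _ ≤ h * (3 * N) * (2 * L) := by gcongr
        _ = _ := by ring
    rw [← mul_le_mul_iff_right₀ hh0]
    calc _ ≤ _ := key
      _ ≤ h * (5 * K * (N : ℝ) * (2 * L)) + h * (6 * N * L) := add_le_add h1 h3
      _ = _ := by ring
  · have hn' := mem_Icc.1 hn
    have hn0 : (1 : ℝ) ≤ n := by exact_mod_cast hn'.1
    have h1 : Real.log n ≤ 2 * L := by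
      have h2 : (n : ℝ) ≤ N ^ 2 := by
        have : (n : ℝ) ≤ N + h := by exact_mod_cast hn'.2
        have h5 : (h : ℝ) ≤ N := by exact_mod_cast hhN
        nlinarith
      calc Real.log n ≤ Real.log ((N : ℝ) ^ 2) := Real.log_le_log (by linarith) h2
        _ = _ := by rw [Real.log_pow, hL]; norm_num
    have h2 : 0 ≤ Real.log n := Real.log_nonneg hn0
    have h3 : 0 ≤ Real.log n ^ 2 * Λ n :=
      mul_nonneg (sq_nonneg _) ArithmeticFunction.vonMangoldt_nonneg
    have h4 : Real.log n ^ 2 ≤ (2 * L) ^ 2 := by gcongr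
    linarith
  · rcases Nat.eq_zero_or_pos m with rfl | hm
    · simp
    · exact hT m hm

/-- The prime number theorem with error term `O(N / log N)`. -/
theorem exists_abs_sum_vonMangoldt_sub_le : ∃ K : ℝ, 0 < K ∧ ∀ N : ℕ, 2 ≤ N →
    |∑ n ∈ Icc 1 N, Λ n - N| ≤ K * N / Real.log N := by
  obtain ⟨K, hK, hD⟩ := exists_abs_sum_log_sq_le
  have h4 : 0 ≤ Real.log 4 := Real.log_nonneg (by norm_num)
  refine ⟨K + 2 * (Real.log 4 + 5), by positivity, fun N hN => ?_⟩
  have hN2 : (2 : ℝ) ≤ N := by exact_mod_cast hN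
  have hN0 : (0 : ℝ) < N := by linarith
  have hDN := hD N hN
  set L := Real.log N with hL
  have hL0 : 0 < L := Real.log_pos (by linarith)
  -- replacing `log² n` by `log² N` costs `O(N log N)`, since `log(N/n)` is bounded on average
  have hsplit : L ^ 2 * (∑ n ∈ Icc 1 N, Λ n - N) = ∑ n ∈ Icc 1 N, Real.log n ^ 2 * (Λ n - 1) +
      ∑ n ∈ Icc 1 N, (Λ n - 1) * (L ^ 2 - Real.log n ^ 2) := by
    have : ∑ n ∈ Icc 1 N, Λ n - (N : ℝ) = ∑ n ∈ Icc 1 N, (Λ n - 1) := by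
      rw [sum_sub_distrib]; simp
    rw [this, mul_sum, ← sum_add_distrib]
    exact sum_congr rfl fun n _ => by ring
  have hsecond : |∑ n ∈ Icc 1 N, (Λ n - 1) * (L ^ 2 - Real.log n ^ 2)| ≤
      2 * L * ((Real.log 4 + 5) * N) := by
    refine (abs_sum_le_sum_abs _ _).trans ?_
    refine le_trans ?_ (mul_le_mul_of_nonneg_left
      (sum_vonMangoldt_add_one_mul_log_sub_le (by omega : 1 ≤ N)) (by positivity))
    rw [mul_sum]
    refine sum_le_sum fun n hn => ?_
    have hn' := mem_Icc.1 hn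
    have hn0 : (1 : ℝ) ≤ n := by exact_mod_cast hn'.1
    have h1 : 0 ≤ Real.log n := Real.log_nonneg hn0
    have h2 : Real.log n ≤ L := Real.log_le_log (by linarith) (by exact_mod_cast hn'.2)
    have h3 : |Λ n - 1| ≤ Λ n + 1 := by
      have := ArithmeticFunction.vonMangoldt_nonneg (n := n)
      rw [abs_le]; constructor <;> linarith
    rw [abs_mul, sq_sub_sq, abs_mul, abs_of_nonneg (by linarith : 0 ≤ L + Real.log n),
      abs_of_nonneg (by linarith : 0 ≤ L - Real.log n)]
    calc _ ≤ (Λ n + 1) * ((2 * L) * (L - Real.log n)) := by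
          refine mul_le_mul h3 (mul_le_mul_of_nonneg_right (by linarith) (by linarith)) ?_
            ((abs_nonneg _).trans h3)
          exact mul_nonneg (by linarith) (by linarith)
      _ = _ := by ring
  have htot : L ^ 2 * |∑ n ∈ Icc 1 N, Λ n - N| ≤ K * N * L + 2 * L * ((Real.log 4 + 5) * N) := by
    rw [← abs_of_pos (by positivity : 0 < L ^ 2), ← abs_mul, hsplit]
    exact (abs_add_le _ _).trans (add_le_add hDN hsecond)
  rw [le_div_iff₀ hL0, ← mul_le_mul_iff_right₀ hL0]
  calc _ = L ^ 2 * |∑ n ∈ Icc 1 N, Λ n - N| := by ring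
    _ ≤ _ := htot
    _ = _ := by ring

end

/-! ### Comparison of the two averages -/

section

open scoped ArithmeticFunction.vonMangoldt
open Finset

lemma card_filter_prime_Icc (N : ℕ) : #{p ∈ Icc 1 N | p.Prime} = Nat.primeCounting N := by
  rw [Nat.primeCounting, Nat.primeCounting', Nat.count_eq_card_filter_range]
  congr 1
  ext p
  simp only [mem_filter, mem_Icc, mem_range]
  exact ⟨fun h => ⟨by omega, h.2⟩, fun h => ⟨⟨h.2.one_le, by omega⟩, h.2⟩⟩

/-- `π(N) log N - θ(N) = O(N / log N)`: on average, the logarithm of a prime `p ≤ N` is within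
`O(1)` of `log N`. -/
lemma exists_primeCounting_mul_log_sub_le : ∃ K : ℝ, 0 < K ∧ ∀ N : ℕ, 2 ≤ N →
    Nat.primeCounting N * Real.log N - ∑ p ∈ Icc 1 N with p.Prime, Real.log p ≤
      K * N / Real.log N := by
  obtain ⟨c, hc⟩ := Chebyshev.primeCounting_sub_theta_div_log_isBigO.bound
  obtain ⟨X, hX⟩ := Filter.eventually_atTop.1 hc
  refine ⟨max c (max X 1 ^ 2), lt_max_of_lt_right (by positivity), fun N hN => ?_⟩
  have hN2 : (2 : ℝ) ≤ N := by exact_mod_cast hN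
  have hN0 : (0 : ℝ) < N := by linarith
  set L := Real.log N with hL
  have hL0 : 0 < L := Real.log_pos (by linarith)
  have hLN : L ≤ N := (Real.log_le_sub_one_of_pos hN0).trans (by linarith)
  -- the bound from Mathlib is asymptotic; below its threshold `X` a trivial bound suffices
  rcases le_total X N with hXN | hXN
  · have h := hX N hXN
    have hθ : Chebyshev.theta N = ∑ p ∈ Icc 1 N with p.Prime, Real.log p := by
      rw [Chebyshev.theta, Nat.floor_natCast]; rfl
    rw [Nat.floor_natCast, hθ, Real.norm_eq_abs,
      Real.norm_of_nonneg (by positivity)] at h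
    have h1 := (abs_le.1 h).2
    rw [sub_le_iff_le_add, ← sub_le_iff_le_add'] at h1
    calc _ = L * (Nat.primeCounting N - (∑ p ∈ Icc 1 N with p.Prime, Real.log p) / L) := by
          field_simp
      _ ≤ L * (c * (N / L ^ 2)) := by gcongr; linarith
      _ = c * N / L := by field_simp
      _ ≤ _ := by gcongr; exact le_max_left _ _
  · have h1 : (Nat.primeCounting N : ℝ) ≤ N := by
      rw [← card_filter_prime_Icc]
      exact_mod_cast (card_filter_le _ _).trans (by simp)
    have h2 : 0 ≤ ∑ p ∈ Icc 1 N with p.Prime, Real.log p :=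
      sum_nonneg fun p _ => Real.log_natCast_nonneg p
    have h3 : (N : ℝ) ≤ max X 1 := hXN.trans (le_max_left _ _)
    have h4 : 1 ≤ N / L := by rwa [le_div_iff₀ hL0, one_mul]
    calc _ ≤ Nat.primeCounting N * L := by linarith
      _ ≤ max X 1 * max X 1 := by gcongr; exacts [h1.trans h3, hLN.trans h3]
      _ = max X 1 ^ 2 * 1 := by ring
      _ ≤ max c (max X 1 ^ 2) * (N / L) := by gcongr; exact le_max_right _ _
      _ = _ := by ring

lemma sum_vonMangoldt_not_prime_le {N : ℕ} (hN : 2 ≤ N) :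
    ∑ n ∈ Icc 1 N with ¬ n.Prime, Λ n ≤ 32 * N / Real.log N := by
  have hN2 : (2 : ℝ) ≤ N := by exact_mod_cast hN
  have hN0 : (0 : ℝ) < N := by linarith
  have h := Chebyshev.psi_sub_theta_le (x := N) (by linarith)
  rw [Chebyshev.psi_sub_theta_eq_sum_not_prime, Nat.floor_natCast] at h
  have hL0 : 0 < Real.log N := Real.log_pos (by linarith)
  refine (h : ∑ n ∈ Icc 1 N with ¬ n.Prime, Λ n ≤ _).trans ?_
  have h1 : Real.log N ≤ (N : ℝ) ^ (1 / 4 : ℝ) / (1 / 4) :=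
    Real.log_le_rpow_div hN0.le (by norm_num)
  have h2 : Real.log N ^ 2 ≤ 16 * √N := by
    calc _ ≤ ((N : ℝ) ^ (1 / 4 : ℝ) / (1 / 4)) ^ 2 := by gcongr
      _ = 16 * ((N : ℝ) ^ (1 / 4 : ℝ)) ^ 2 := by ring
      _ = _ := by rw [← Real.rpow_natCast, ← Real.rpow_mul hN0.le, Real.sqrt_eq_rpow]; norm_num
  rw [le_div_iff₀ hL0]
  calc _ = 2 * √N * Real.log N ^ 2 := by ring
    _ ≤ 2 * √N * (16 * √N) := by gcongr
    _ = 32 * (√N * √N) := by ring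
    _ = _ := by rw [Real.mul_self_sqrt hN0.le]

/-- The two weights on primes are close in `ℓ¹`, including the mass of `Λ` on proper prime
powers. -/
lemma exists_sum_abs_weight_sub_le : ∃ K : ℝ, 0 < K ∧ ∀ N : ℕ, 2 ≤ N →
    ∑ p ∈ Icc 1 N with p.Prime, |1 / (Nat.primeCounting N : ℝ) - Real.log p / N| +
      (∑ n ∈ Icc 1 N with ¬ n.Prime, Λ n) / N ≤ K / Real.log N := by
  obtain ⟨K₁, hK₁, h₁⟩ := exists_abs_sum_vonMangoldt_sub_le
  obtain ⟨K₂, hK₂, h₂⟩ := exists_primeCounting_mul_log_sub_le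
  refine ⟨K₁ + 2 * K₂ + 64, by positivity, fun N hN => ?_⟩
  have hN2 : (2 : ℝ) ≤ N := by exact_mod_cast hN
  have hN0 : (0 : ℝ) < N := by linarith
  have H₁ := h₁ N hN
  have H₂ := h₂ N hN
  have H₃ := sum_vonMangoldt_not_prime_le hN
  have hπ : (0 : ℝ) < Nat.primeCounting N := by
    rw [← card_filter_prime_Icc]
    exact_mod_cast card_pos.2 ⟨2, mem_filter.2 ⟨mem_Icc.2 ⟨by norm_num, hN⟩, Nat.prime_two⟩⟩
  have hψ : ∑ n ∈ Icc 1 N, Λ n = ∑ p ∈ Icc 1 N with p.Prime, Real.log p +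
      ∑ n ∈ Icc 1 N with ¬ n.Prime, Λ n := by
    rw [← sum_filter_add_sum_filter_not _ Nat.Prime]
    congr 1
    exact sum_congr rfl fun p hp =>
      ArithmeticFunction.vonMangoldt_apply_prime (mem_filter.1 hp).2
  have hE : 0 ≤ ∑ n ∈ Icc 1 N with ¬ n.Prime, Λ n :=
    sum_nonneg fun n _ => ArithmeticFunction.vonMangoldt_nonneg
  set L := Real.log N with hL
  have hL0 : 0 < L := Real.log_pos (by linarith)
  set θ := ∑ p ∈ Icc 1 N with p.Prime, Real.log p with hθ
  set E := ∑ n ∈ Icc 1 N with ¬ n.Prime, Λ n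
  set P : ℝ := (Nat.primeCounting N : ℝ) with hP
  have hcard : ((#{p ∈ Icc 1 N | p.Prime} : ℕ) : ℝ) = P := by rw [card_filter_prime_Icc]
  have hsum : ∑ p ∈ Icc 1 N with p.Prime, |1 / P - Real.log p / N| ≤
      P * |1 / P - L / N| + (P * L - θ) / N := by
    calc _ ≤ ∑ p ∈ Icc 1 N with p.Prime, (|1 / P - L / N| + (L - Real.log p) / N) := by
          refine sum_le_sum fun p hp => ?_
          have hp' := mem_filter.1 hp
          have h4 : Real.log p ≤ L := Real.log_le_log (by exact_mod_cast hp'.2.pos)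
            (by exact_mod_cast (mem_Icc.1 hp'.1).2)
          have h5 : 1 / P - Real.log p / N = (1 / P - L / N) + (L - Real.log p) / N := by ring
          rw [h5]
          refine (abs_add_le _ _).trans (le_of_eq ?_)
          rw [abs_of_nonneg (div_nonneg (sub_nonneg.2 h4) hN0.le)]
      _ = _ := by
          rw [sum_add_distrib, ← sum_div, sum_sub_distrib, sum_const, sum_const, nsmul_eq_mul,
            nsmul_eq_mul, hcard]
  have habs : P * |1 / P - L / N| = |N - P * L| / N := by
    rw [← abs_of_pos hπ, ← abs_mul, abs_of_pos hπ, ← abs_of_pos hN0, ← abs_div, abs_of_pos hN0]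
    congr 1
    field_simp
  have hPL : |N - P * L| ≤ (K₁ + K₂ + 32) * N / L := by
    have h6 : (K₁ + K₂ + 32) * N / L = K₁ * N / L + K₂ * N / L + 32 * N / L := by ring
    have hPθ : 0 ≤ P * L - θ := by
      have : θ ≤ ∑ p ∈ Icc 1 N with p.Prime, L := sum_le_sum fun p hp => by
        have hp' := mem_filter.1 hp
        exact Real.log_le_log (by exact_mod_cast hp'.2.pos)
          (by exact_mod_cast (mem_Icc.1 hp'.1).2)
      rw [sum_const, nsmul_eq_mul, hcard] at this
      linarith
    rw [hψ, abs_le] at H₁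
    rw [h6, abs_le]
    constructor <;> linarith
  rw [habs] at hsum
  calc _ ≤ (|N - P * L| + (P * L - θ) + E) / N := by
        rw [add_div, add_div]; gcongr
    _ ≤ ((K₁ + K₂ + 32) * N / L + K₂ * N / L + 32 * N / L) / N := by gcongr
    _ = _ := by field_simp; ring

theorem lemma4p2 :
    ∃ C : ℝ, 0 < C ∧
      ∀ (a : ℕ → ℂ) (M : ℝ), (∀ n : ℕ, 1 ≤ n → ‖a n‖ ≤ M) →
        ∀ N : ℕ, 2 ≤ N →
          ‖(1 / (Nat.primeCounting N : ℂ)) * ∑ p ∈ (Finset.Icc 1 N).filter Nat.Prime, a p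
              - (1 / (N : ℂ)) *
                  ∑ n ∈ Finset.Icc 1 N, ((ArithmeticFunction.vonMangoldt n : ℝ) : ℂ) * a n‖
            ≤ M * (8 * C / Real.log N + 6 * C ^ 2 / (Real.log N) ^ 2
                + (Real.log N) ^ 2 / (2 * Real.sqrt N * Real.log 2)) := by
  obtain ⟨K, hK, h⟩ := exists_sum_abs_weight_sub_le
  -- with this `C` the first term of the bound is `K / log N`, and the other two are nonnegative
  refine ⟨K / 8, by positivity, fun a M ha N hN => ?_⟩
  have hM : 0 ≤ M := (norm_nonneg _).trans (ha 1 le_rfl)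
  have hN0 : (0 : ℝ) < N := by exact_mod_cast (by omega : 0 < N)
  have hL0 : 0 < Real.log N := Real.log_pos (by exact_mod_cast (by omega : 1 < N))
  have hl2 : 0 < Real.log 2 := Real.log_pos (by norm_num)
  have hrw : (1 / (Nat.primeCounting N : ℂ)) * ∑ p ∈ Icc 1 N with p.Prime, a p
      - (1 / (N : ℂ)) * ∑ n ∈ Icc 1 N, ((Λ n : ℝ) : ℂ) * a n =
      ∑ p ∈ Icc 1 N with p.Prime,
        ((1 / (Nat.primeCounting N : ℝ) - Real.log p / N : ℝ) : ℂ) * a p -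
      (1 / (N : ℂ)) * ∑ n ∈ Icc 1 N with ¬ n.Prime, ((Λ n : ℝ) : ℂ) * a n := by
    rw [← sum_filter_add_sum_filter_not (Icc 1 N) Nat.Prime (fun n => ((Λ n : ℝ) : ℂ) * a n),
      mul_add, ← sub_sub, mul_sum, mul_sum, ← sum_sub_distrib]
    congr 1
    refine sum_congr rfl fun p hp => ?_
    rw [ArithmeticFunction.vonMangoldt_apply_prime (mem_filter.1 hp).2]
    push_cast
    ring
  have hfirst : ‖∑ p ∈ Icc 1 N with p.Prime,
      ((1 / (Nat.primeCounting N : ℝ) - Real.log p / N : ℝ) : ℂ) * a p‖ ≤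
      (∑ p ∈ Icc 1 N with p.Prime, |1 / (Nat.primeCounting N : ℝ) - Real.log p / N|) * M := by
    rw [sum_mul]
    refine norm_sum_le_of_le _ fun p hp => ?_
    rw [norm_mul, Complex.norm_real, Real.norm_eq_abs]
    gcongr
    exact ha p (mem_filter.1 hp).2.one_le
  have hsecond : ‖(1 / (N : ℂ)) * ∑ n ∈ Icc 1 N with ¬ n.Prime, ((Λ n : ℝ) : ℂ) * a n‖ ≤
      (∑ n ∈ Icc 1 N with ¬ n.Prime, Λ n) / N * M := by
    rw [norm_mul, norm_div, norm_one, Complex.norm_natCast, div_mul_eq_mul_div, one_mul,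
      div_mul_eq_mul_div]
    gcongr
    rw [sum_mul]
    refine norm_sum_le_of_le _ fun n hn => ?_
    rw [norm_mul, Complex.norm_real, Real.norm_of_nonneg ArithmeticFunction.vonMangoldt_nonneg]
    exact mul_le_mul_of_nonneg_left (ha n (mem_Icc.1 (mem_filter.1 hn).1).1)
      ArithmeticFunction.vonMangoldt_nonneg
  rw [hrw]
  calc _ ≤ _ := (norm_sub_le _ _).trans (add_le_add hfirst hsecond)
    _ = M * (∑ p ∈ Icc 1 N with p.Prime, |1 / (Nat.primeCounting N : ℝ) - Real.log p / N| +
          (∑ n ∈ Icc 1 N with ¬ n.Prime, Λ n) / N) := by ring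
    _ ≤ M * (8 * (K / 8) / Real.log N) := by
        rw [mul_div_cancel₀ _ (by norm_num : (8 : ℝ) ≠ 0)]
        exact mul_le_mul_of_nonneg_left (h N hN) hM
    _ ≤ _ := by
        gcongr
        rw [add_assoc]
        exact le_add_of_nonneg_right (by positivity)

end
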